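/- Let $K$ be a field of characteristic $0$, let $L_4$ be the free Lie algebra over $K$ with free generators $x_1,x_2,x_3,x_4$, and let $L_4/L_4''$ be the free metabelian Lie algebra of rank $4$, with free generators denoted by the same symbols. Commutators are left normed, $[a,b,c]=[[a,b],c]$. The commutator ideal $L_4'/L_4''$ is a module over the polynomial algebra $K[X_4]=K[x_1,x_2,x_3,x_4]$, where $u\cdot x_i=[u,x_i]$. Let $\delta=\delta(3)$ be the derivation with $$\delta(x_1)=0,\quad \delta(x_2)=x_1,\quad \delta(x_3)=x_2,\quad \delta(x_4)=x_3,$$ both of $K[X_4]$ and of $L_4/L_4''$, and let $(\cdot)^\delta$ denote the kernel of $\delta$ (the constants). Put $$f_1=x_1,\quad f_2=x_2^2-2x_1x_3,\quad f_3=x_2^3-3x_1x_2x_3+3x_1^2x_4,$$ $$f_4=x_2^2x_3^2-2x_2^3x_4+6x_1x_2x_3x_4-\tfrac83x_1x_3^3-3x_1^2x_4^2,$$ and define the following elements of $L_4'/L_4''$: $$c_1=[x_2,x_1],\quad c_2=[x_4,x_1]-[x_3,x_2],\quad c_3=[x_3,x_1,x_1]-[x_2,x_1,x_2],$$ $$c_4=3[x_2,x_1,x_4]-2[x_3,x_1,x_3]+[x_3,x_2,x_2],$$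 $$c_5=3(-[x_3,x_1,x_1,x_4]+[x_2,x_1,x_2,x_4]+[x_3,x_1,x_2,x_3])-4[x_2,x_1,x_3,x_3]-[x_3,x_2,x_2,x_2],$$ $$\begin{aligned}c_6={}&-9[x_2,x_1,x_1,x_4,x_4]+18[x_3,x_1,x_1,x_3,x_4]-12[x_4,x_1,x_1,x_3,x_3]-9[x_3,x_1,x_2,x_2,x_4]\\&+12[x_4,x_1,x_2,x_2,x_3]+4[x_2,x_1,x_3,x_3,x_3]-6[x_3,x_1,x_2,x_3,x_3]\\&-3[x_4,x_2,x_2,x_2,x_2]+3[x_3,x_2,x_2,x_2,x_3],\end{aligned}$$ $$\begin{aligned}c_7={}&-18[x_3,x_1,x_1,x_1,x_4,x_4]+18[x_4,x_1,x_1,x_1,x_3,x_4]+18[x_2,x_1,x_1,x_2,x_4,x_4]-9[x_4,x_1,x_1,x_2,x_2,x_4]\\&-18[x_2,x_1,x_1,x_3,x_3,x_4]+18[x_3,x_1,x_1,x_2,x_3,x_4]-18[x_4,x_1,x_1,x_2,x_3,x_3]+8[x_3,x_1,x_1,x_3,x_3,x_3]\\&-9[x_2,x_1,x_2,x_2,x_3,x_4]-3[x_3,x_1,x_2,x_2,x_2,x_4]+15[x_4,x_1,x_2,x_2,x_2,x_3]+10[x_2,x_1,x_2,x_3,x_3,x_3]\\&-12[x_3,x_1,x_2,x_2,x_3,x_3]-3[x_4,x_2,x_2,x_2,x_2,x_2]+3[x_3,x_2,x_2,x_2,x_2,x_3].\end{aligned}$$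 Then $f_1,f_2,f_3,f_4\in K[X_4]^\delta$, and the following hold. (a) The $K[X_4]^\delta$-module $(L_4'/L_4'')^\delta$ is generated by $c_1,\dots,c_7$. (b) The generators satisfy the relations $$\begin{aligned} R_1:&\quad c_1f_3=-c_3f_2+c_4f_1^2,\\ R_2:&\quad c_3f_3=-(c_1f_2^2+c_5f_1^2),\\ R_3:&\quad c_4f_3=-(3c_1f_4+c_5f_2),\\ R_4:&\quad c_6f_1=3(c_1f_4-c_2f_2^2+c_5f_2),\\ R_5:&\quad c_5f_3=3c_3f_4-c_4f_2^2,\\ R_6:&\quad c_7f_1=3(-c_2f_2f_3+2c_3f_4-c_4f_2^2),\\ R_7:&\quad c_6f_3=3c_4f_1f_4+c_7f_2,\\ R_8:&\quad c_7f_3=9c_2f_1f_2f_4-6c_5f_1f_4+c_6f_2^2. \end{aligned}$$ (c) The elements $c_jf_1^qf_2^rf_4^s$ ($j=1,3,4,5$; $q,r,s\ge 0$), $c_jf_2^rf_4^s$ ($j=6,7$; $r,s\ge 0$) and $c_2f_1^qf_2^rf_3^{\varepsilon}f_4^s$ ($q,r,s\ge 0$, $\varepsilon\in\{0,1\}$)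 form a basis of the $K$-vector space $(L_4'/L_4'')^\delta$. (d) The Lie algebra $(L_4/L_4'')^\delta$ is generated by the infinite set $$\{x_1\}\cup\{c_jf_2^rf_4^s\mid 1\le j\le 7,\ r,s\ge 0\}\cup\{c_2f_2^rf_3f_4^s\mid r,s\ge 0\}.$$ -/

import Mathlib

noncomputable section

namespace FreeMetab

/-! ### The free metabelian Lie algebra -/

/-- The free metabelian Lie algebra `L / L''`, where `L` is the free Lie algebra over `K` with
free generators indexed by `ι`. -/
abbrev FreeMetabelian (K : Type*) [Field K] (ι : Type*) :=
  FreeLieAlgebra K ι ⧸ LieAlgebra.derivedSeries K (FreeLieAlgebra K ι) 2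

/-- The commutator ideal `L' / L''` of the free metabelian Lie algebra `L / L''`. -/
abbrev CommutatorIdeal (K : Type*) [Field K] (ι : Type*) :=
  ↥(LieAlgebra.derivedSeries K (FreeMetabelian K ι) 1)

variable (K : Type*) [Field K] {ι : Type*}

/-- The canonical projection `L → L / L''`. -/
def proj (ι : Type*) : FreeLieAlgebra K ι →ₗ⁅K⁆ FreeMetabelian K ι where
  toFun a := LieSubmodule.Quotient.mk a
  map_add' _ _ := rfl
  map_smul' _ _ := rfl
  map_lie' {a b} := LieSubmodule.Quotient.mk_bracket _ a b

/-- The free generators `x_i` of `L / L''`. -/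
def gen (i : ι) : FreeMetabelian K ι := proj K ι (FreeLieAlgebra.of K i)

theorem proj_surjective : Function.Surjective (proj K ι) :=
  fun a => LieSubmodule.Quotient.surjective_mk' _ a

theorem proj_ker : (proj K ι).ker = LieAlgebra.derivedSeries K (FreeLieAlgebra K ι) 2 :=
  LieSubmodule.ext _ _ fun _ => LieHom.mem_ker.trans (LieSubmodule.Quotient.mk_eq_zero _)

theorem derivedSeries_succ {L : Type*} [LieRing L] [LieAlgebra K L] (k : ℕ) :
    LieAlgebra.derivedSeries K L (k + 1)
      = ⁅LieAlgebra.derivedSeries K L k, LieAlgebra.derivedSeries K L k⁆ :=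
  LieAlgebra.derivedSeriesOfIdeal_succ K L ⊤ k

theorem derivedSeries_two_eq_bot : LieAlgebra.derivedSeries K (FreeMetabelian K ι) 2 = ⊥ := by
  rw [← LieIdeal.derivedSeries_map_eq 2 (proj_surjective K (ι := ι)), LieIdeal.map_eq_bot_iff,
    proj_ker]

theorem lie_mem_commutator (a b : FreeMetabelian K ι) :
    ⁅a, b⁆ ∈ LieAlgebra.derivedSeries K (FreeMetabelian K ι) 1 := by
  rw [derivedSeries_succ K 0]
  exact LieSubmodule.lie_mem_lie (LieSubmodule.mem_top a) (LieSubmodule.mem_top b)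

/-- The metabelian identity. -/
theorem lie_eq_zero {a b : FreeMetabelian K ι}
    (ha : a ∈ LieAlgebra.derivedSeries K (FreeMetabelian K ι) 1)
    (hb : b ∈ LieAlgebra.derivedSeries K (FreeMetabelian K ι) 1) : ⁅a, b⁆ = 0 := by
  have h : ⁅a, b⁆ ∈ LieAlgebra.derivedSeries K (FreeMetabelian K ι) 2 := by
    rw [derivedSeries_succ (L := FreeMetabelian K ι) K 1]
    exact LieSubmodule.lie_mem_lie ha hb
  rw [derivedSeries_two_eq_bot] at h
  simpa using h

/-! ### The action of the polynomial algebra on the commutator ideal -/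

/-- The operator `u ↦ [u, x_i]` on the commutator ideal. -/
def adGen (i : ι) : Module.End K (CommutatorIdeal K ι) where
  toFun u := ⟨⁅(u : FreeMetabelian K ι), gen K i⁆, lie_mem_commutator K _ _⟩
  map_add' u v := Subtype.ext (by simp)
  map_smul' a u := Subtype.ext (by simp)

theorem adGen_comm (i j : ι) : adGen K i * adGen K j = adGen K j * adGen K i := by
  refine LinearMap.ext fun u => Subtype.ext ?_
  change ⁅⁅(u : FreeMetabelian K ι), gen K j⁆, gen K i⁆
    = ⁅⁅(u : FreeMetabelian K ι), gen K i⁆, gen K j⁆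
  have h := lie_eq_zero K u.2 (lie_mem_commutator K (gen K j) (gen K i))
  rw [leibniz_lie] at h
  rw [eq_neg_of_add_eq_zero_left h, ← lie_skew, neg_neg]

/-- The commutative subalgebra of operators generated by all `u ↦ [u, x_i]`. -/
abbrev adAlgebra (ι : Type*) : Subalgebra K (Module.End K (CommutatorIdeal K ι)) :=
  Algebra.adjoin K (Set.range (adGen K : ι → _))

instance : CommRing (adAlgebra K ι) :=
  { (inferInstance : Ring (adAlgebra K ι)) with
    mul_comm := by
      have := Algebra.isMulCommutative_adjoin K (s := Set.range (adGen K : ι → _))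
        (by rintro _ ⟨i, rfl⟩ _ ⟨j, rfl⟩; exact adGen_comm K i j)
      exact fun a b => this.is_comm.comm a b }

/-- The algebra homomorphism `f(x_1, …, x_d) ↦ f(ad x_1, …, ad x_d)`, where `ad x_i` is the
operator `u ↦ [u, x_i]` on the commutator ideal. -/
def polyAct (ι : Type*) : MvPolynomial ι K →ₐ[K] Module.End K (CommutatorIdeal K ι) :=
  (adAlgebra K ι).val.comp
    (MvPolynomial.aeval fun i => (⟨adGen K i, Algebra.subset_adjoin ⟨i, rfl⟩⟩ : adAlgebra K ι))

/-- The `K[X]`-module structure on `L' / L''`: the product of `u` and `f` is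
`u f(ad x_1, …, ad x_d)`. -/
instance : Module (MvPolynomial ι K) (CommutatorIdeal K ι) :=
  Module.compHom (CommutatorIdeal K ι) (polyAct K ι).toRingHom

variable {K}

theorem poly_smul_def (p : MvPolynomial ι K) (u : CommutatorIdeal K ι) :
    p • u = polyAct K ι p u := rfl

theorem X_smul (i : ι) (u : CommutatorIdeal K ι) :
    (MvPolynomial.X i : MvPolynomial ι K) • u = adGen K i u := by
  simp [poly_smul_def, polyAct]

theorem C_smul (a : K) (u : CommutatorIdeal K ι) :
    (MvPolynomial.C a : MvPolynomial ι K) • u = a • u := by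
  rw [poly_smul_def, ← MvPolynomial.algebraMap_eq, AlgHom.commutes, Module.algebraMap_end_apply]

instance : IsScalarTower K (MvPolynomial ι K) (CommutatorIdeal K ι) where
  smul_assoc a p u := by
    rw [poly_smul_def, poly_smul_def, map_smul, LinearMap.smul_apply]

variable (K)

/-- The left normed commutator `[x_i, x_j, x_{k_1}, …, x_{k_n}]`. -/
def com (i j : ι) (l : List ι) : CommutatorIdeal K ι :=
  l.foldl (fun u k => adGen K k u) ⟨⁅gen K i, gen K j⁆, lie_mem_commutator K _ _⟩

/-! ### Derivations of the free metabelian Lie algebra -/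

/-- The Lie algebra `M ⊕ ε M` with `ε² = 0`, where `M = L / L''`; the pair `(a, b)` stands for
`a + ε b`. -/
@[ext] structure Dual (ι : Type*) where
  fst : FreeMetabelian K ι
  snd : FreeMetabelian K ι

namespace Dual

/-- The identification with pairs. -/
def toProd : Dual K ι ≃ FreeMetabelian K ι × FreeMetabelian K ι where
  toFun a := (a.fst, a.snd)
  invFun a := ⟨a.1, a.2⟩
  left_inv _ := rfl
  right_inv _ := rfl

instance : AddCommGroup (Dual K ι) := (toProd K).addCommGroup

instance : Module K (Dual K ι) := (toProd K).module K

variable {K}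

@[simp] theorem fst_add (a b : Dual K ι) : (a + b).fst = a.fst + b.fst := rfl
@[simp] theorem snd_add (a b : Dual K ι) : (a + b).snd = a.snd + b.snd := rfl
@[simp] theorem fst_zero : (0 : Dual K ι).fst = 0 := rfl
@[simp] theorem snd_zero : (0 : Dual K ι).snd = 0 := rfl
@[simp] theorem fst_smul (r : K) (a : Dual K ι) : (r • a).fst = r • a.fst := rfl
@[simp] theorem snd_smul (r : K) (a : Dual K ι) : (r • a).snd = r • a.snd := rfl

instance : Bracket (Dual K ι) (Dual K ι) where
  bracket a b := ⟨⁅a.fst, b.fst⁆, ⁅a.fst, b.snd⁆ + ⁅a.snd, b.fst⁆⟩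

@[simp] theorem fst_lie (a b : Dual K ι) : ⁅a, b⁆.fst = ⁅a.fst, b.fst⁆ := rfl
@[simp] theorem snd_lie (a b : Dual K ι) :
    ⁅a, b⁆.snd = ⁅a.fst, b.snd⁆ + ⁅a.snd, b.fst⁆ := rfl

instance : LieRing (Dual K ι) where
  add_lie a b c := by ext <;> simp; abel
  lie_add a b c := by ext <;> simp; abel
  lie_self a := by
    ext
    · simp
    · rw [snd_lie, ← lie_skew a.fst a.snd, neg_add_cancel, snd_zero]
  leibniz_lie a b c := by
    ext
    · simp
    · simp only [snd_lie, fst_lie, snd_add, lie_add, add_lie]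
      rw [leibniz_lie a.fst b.fst c.snd, leibniz_lie a.fst b.snd c.fst,
        leibniz_lie a.snd b.fst c.fst]
      abel

instance : LieAlgebra K (Dual K ι) where
  lie_smul r a b := by ext <;> simp

end Dual

variable {K}

/-- The homomorphism `L → M ⊕ ε M` with `x_i ↦ x_i + ε v_i`. -/
def dualLift (v : ι → FreeMetabelian K ι) : FreeLieAlgebra K ι →ₗ⁅K⁆ Dual K ι :=
  FreeLieAlgebra.lift K fun i => ⟨gen K i, v i⟩

theorem dualLift_fst (v : ι → FreeMetabelian K ι) (a : FreeLieAlgebra K ι) :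
    (dualLift v a).fst = proj K ι a := by
  let p : Dual K ι →ₗ⁅K⁆ FreeMetabelian K ι :=
    { toFun := Dual.fst
      map_add' := Dual.fst_add
      map_smul' := Dual.fst_smul
      map_lie' := Dual.fst_lie _ _ }
  have : p.comp (dualLift v) = proj K ι := FreeLieAlgebra.hom_ext fun i => by
    rw [LieHom.comp_apply, dualLift, FreeLieAlgebra.lift_of_apply]; rfl
  exact LieHom.congr_fun this a

/-- The linear map `D : L → L / L''` with `D [a, b] = [a, D b] + [D a, b]` and `D x_i = v_i`. -/
def preDer (v : ι → FreeMetabelian K ι) : FreeLieAlgebra K ι →ₗ[K] FreeMetabelian K ι where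
  toFun a := (dualLift v a).snd
  map_add' a b := by simp
  map_smul' r a := by simp

theorem preDer_lie (v : ι → FreeMetabelian K ι) (a b : FreeLieAlgebra K ι) :
    preDer v ⁅a, b⁆ = ⁅proj K ι a, preDer v b⁆ + ⁅preDer v a, proj K ι b⁆ := by
  simp [preDer, dualLift_fst]

theorem preDer_mem (v : ι → FreeMetabelian K ι) {a : FreeLieAlgebra K ι}
    (ha : a ∈ LieAlgebra.derivedSeries K (FreeLieAlgebra K ι) 1) :
    preDer v a ∈ LieAlgebra.derivedSeries K (FreeMetabelian K ι) 1 := by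
  rw [derivedSeries_succ K 0, ← LieSubmodule.mem_toSubmodule,
    LieSubmodule.lieIdeal_oper_eq_linear_span'] at ha
  induction ha using Submodule.span_induction with
  | mem x hx =>
    obtain ⟨m, -, n, -, rfl⟩ := hx
    rw [preDer_lie]
    exact add_mem (lie_mem_commutator K _ _) (lie_mem_commutator K _ _)
  | zero => simp
  | add x y _ _ hx hy => rw [map_add]; exact add_mem hx hy
  | smul r x _ hx => rw [map_smul]; exact Submodule.smul_mem _ r hx

theorem proj_mem {a : FreeLieAlgebra K ι}
    (ha : a ∈ LieAlgebra.derivedSeries K (FreeLieAlgebra K ι) 1) :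
    proj K ι a ∈ LieAlgebra.derivedSeries K (FreeMetabelian K ι) 1 := by
  rw [← LieIdeal.derivedSeries_map_eq 1 (proj_surjective K (ι := ι))]
  exact LieIdeal.mem_map ha

theorem preDer_eq_zero (v : ι → FreeMetabelian K ι) {a : FreeLieAlgebra K ι}
    (ha : a ∈ LieAlgebra.derivedSeries K (FreeLieAlgebra K ι) 2) : preDer v a = 0 := by
  rw [derivedSeries_succ K 1, ← LieSubmodule.mem_toSubmodule,
    LieSubmodule.lieIdeal_oper_eq_linear_span'] at ha
  induction ha using Submodule.span_induction with
  | mem x hx =>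
    obtain ⟨m, hm, n, hn, rfl⟩ := hx
    rw [preDer_lie, lie_eq_zero K (proj_mem hm) (preDer_mem v hn),
      lie_eq_zero K (preDer_mem v hm) (proj_mem hn), add_zero]
  | zero => simp
  | add x y _ _ hx hy => rw [map_add, hx, hy, add_zero]
  | smul r x _ hx => rw [map_smul, hx, smul_zero]

/-- The linear map underlying the derivation that extends the map `x_i ↦ v_i`. -/
def lieDerLinear (v : ι → FreeMetabelian K ι) : FreeMetabelian K ι →ₗ[K] FreeMetabelian K ι :=
  Submodule.liftQ (LieAlgebra.derivedSeries K (FreeLieAlgebra K ι) 2).toSubmodule (preDer v)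
    fun _ ha => preDer_eq_zero v ha

theorem lieDerLinear_proj (v : ι → FreeMetabelian K ι) (a : FreeLieAlgebra K ι) :
    lieDerLinear v (proj K ι a) = preDer v a := rfl

/-- The derivation of the free metabelian Lie algebra that extends the map `x_i ↦ v_i`. -/
def lieDer (v : ι → FreeMetabelian K ι) :
    LieDerivation K (FreeMetabelian K ι) (FreeMetabelian K ι) where
  toLinearMap := lieDerLinear v
  leibniz' a b := by
    obtain ⟨a, rfl⟩ := proj_surjective K a
    obtain ⟨b, rfl⟩ := proj_surjective K b
    rw [← LieHom.map_lie, ← lie_skew (proj K ι b), sub_neg_eq_add, lieDerLinear_proj,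
      lieDerLinear_proj, lieDerLinear_proj, preDer_lie]

theorem lieDer_gen (v : ι → FreeMetabelian K ι) (i : ι) : lieDer v (gen K i) = v i := by
  change lieDerLinear v (proj K ι (FreeLieAlgebra.of K i)) = v i
  rw [lieDerLinear_proj]
  change (dualLift v (FreeLieAlgebra.of K i)).snd = v i
  rw [dualLift, FreeLieAlgebra.lift_of_apply]

theorem lieDer_mem (v : ι → FreeMetabelian K ι) {u : FreeMetabelian K ι}
    (hu : u ∈ LieAlgebra.derivedSeries K (FreeMetabelian K ι) 1) :
    lieDer v u ∈ LieAlgebra.derivedSeries K (FreeMetabelian K ι) 1 := by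
  rw [derivedSeries_succ K 0, ← LieSubmodule.mem_toSubmodule,
    LieSubmodule.lieIdeal_oper_eq_linear_span'] at hu
  induction hu using Submodule.span_induction with
  | mem x hx =>
    obtain ⟨m, -, n, -, rfl⟩ := hx
    rw [LieDerivation.apply_lie_eq_add]
    exact add_mem (lie_mem_commutator K _ _) (lie_mem_commutator K _ _)
  | zero => simp
  | add x y _ _ hx hy => rw [map_add]; exact add_mem hx hy
  | smul r x _ hx => rw [map_smul]; exact Submodule.smul_mem _ r hx

/-! ### Linear derivations and their constants -/

/-- The derivation of `K[X]` with `δ(x_j) = ∑ i, α_{ij} x_i`. -/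
def polyDelta [Fintype ι] (α : Matrix ι ι K) :
    Derivation K (MvPolynomial ι K) (MvPolynomial ι K) :=
  MvPolynomial.mkDerivation K fun j => ∑ i, α i j • MvPolynomial.X i

/-- The derivation of the free metabelian Lie algebra with `δ(x_j) = ∑ i, α_{ij} x_i`. -/
def lieDelta [Fintype ι] (α : Matrix ι ι K) :
    LieDerivation K (FreeMetabelian K ι) (FreeMetabelian K ι) :=
  lieDer fun j => ∑ i, α i j • gen K i

/-- The restriction of `δ` to the commutator ideal. -/
def commDelta [Fintype ι] (α : Matrix ι ι K) :
    CommutatorIdeal K ι →ₗ[K] CommutatorIdeal K ι where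
  toFun u := ⟨lieDelta α u, lieDer_mem _ u.2⟩
  map_add' u v := Subtype.ext (by simp)
  map_smul' r u := Subtype.ext (by simp)

theorem commDelta_adGen [Fintype ι] (α : Matrix ι ι K) (j : ι) (u : CommutatorIdeal K ι) :
    commDelta α (adGen K j u) = adGen K j (commDelta α u) + ∑ i, α i j • adGen K i u := by
  apply Subtype.ext
  have h : lieDelta α ⁅(u : FreeMetabelian K ι), gen K j⁆
      = ⁅(u : FreeMetabelian K ι), ∑ i, α i j • gen K i⁆ + ⁅lieDelta α u, gen K j⁆ := by
    rw [LieDerivation.apply_lie_eq_add]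
    congr 2
    exact lieDer_gen _ j
  rw [lie_sum] at h
  simp only [lie_smul] at h
  change lieDelta α ⁅(u : FreeMetabelian K ι), gen K j⁆ = _
  rw [h, add_comm]
  simp [adGen, commDelta]

/-- `δ(u f) = δ(u) f + u δ(f)`. -/
theorem commDelta_smul [Fintype ι] (α : Matrix ι ι K) (p : MvPolynomial ι K)
    (u : CommutatorIdeal K ι) :
    commDelta α (p • u) = p • commDelta α u + polyDelta α p • u := by
  induction p using MvPolynomial.induction_on generalizing u with
  | C a => simp [C_smul, polyDelta]
  | add p q hp hq => simp only [add_smul, map_add, hp, hq]; abel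
  | mul_X p j hp =>
    have h : polyDelta α (MvPolynomial.X j) = ∑ i, α i j • MvPolynomial.X i :=
      MvPolynomial.mkDerivation_X _ _ _
    rw [mul_smul, hp, X_smul, commDelta_adGen, Derivation.leibniz, h, smul_add, add_smul,
      smul_eq_mul, smul_eq_mul, mul_smul, mul_smul, X_smul, add_assoc,
      mul_comm (MvPolynomial.X j), mul_smul, X_smul]
    simp only [Finset.sum_smul, smul_assoc, X_smul]

/-- The algebra of constants `K[X]^δ`. -/
def polyConst [Fintype ι] (α : Matrix ι ι K) : Subalgebra K (MvPolynomial ι K) where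
  carrier := {p | polyDelta α p = 0}
  mul_mem' {p q} hp hq := by
    rw [Set.mem_ofPred_eq] at *
    rw [Derivation.leibniz, hp, hq, smul_zero, smul_zero, add_zero]
  add_mem' {p q} hp hq := by
    rw [Set.mem_ofPred_eq] at *
    rw [map_add, hp, hq, add_zero]
  algebraMap_mem' r := Derivation.map_algebraMap _ r

/-- The algebra of constants `(L / L'')^δ`. -/
def lieConst [Fintype ι] (α : Matrix ι ι K) : LieSubalgebra K (FreeMetabelian K ι) where
  carrier := {u | lieDelta α u = 0}
  add_mem' {u v} hu hv := by
    rw [Set.mem_ofPred_eq] at *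
    rw [map_add, hu, hv, add_zero]
  zero_mem' := map_zero _
  smul_mem' r u hu := by
    rw [Set.mem_ofPred_eq] at *
    rw [map_smul, hu, smul_zero]
  lie_mem' {u v} hu hv := by
    change lieDelta α u = 0 at hu
    change lieDelta α v = 0 at hv
    change lieDelta α ⁅u, v⁆ = 0
    rw [LieDerivation.apply_lie_eq_add, hu, hv, lie_zero, zero_lie, add_zero]

/-- The `K[X]^δ`-module of constants `(L' / L'')^δ`. -/
def commConst [Fintype ι] (α : Matrix ι ι K) :
    Submodule (polyConst α) (CommutatorIdeal K ι) where
  carrier := {u | lieDelta α (u : FreeMetabelian K ι) = 0}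
  add_mem' {u v} hu hv := by
    rw [Set.mem_ofPred_eq] at *
    rw [LieSubmodule.coe_add, map_add, hu, hv, add_zero]
  zero_mem' := map_zero _
  smul_mem' p u hu := by
    have hu' : commDelta α u = 0 := Subtype.ext hu
    have hp : polyDelta α (p : MvPolynomial ι K) = 0 := p.2
    have h := commDelta_smul α (p : MvPolynomial ι K) u
    rw [hu', hp, smul_zero, zero_smul, add_zero] at h
    exact congrArg Subtype.val h

/-! ### The derivation `δ(3)` for `d = 4` -/

variable (K)

/-- The nilpotent Jordan cell of size `4`: it gives the derivation `δ = δ(3)` with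
`δ(x_1) = 0`, `δ(x_2) = x_1`, `δ(x_3) = x_2`, `δ(x_4) = x_3`. -/
def J : Matrix (Fin 4) (Fin 4) K :=
  !![0, 1, 0, 0;
     0, 0, 1, 0;
     0, 0, 0, 1;
     0, 0, 0, 0]

/-- The index of the variable `x_1`. -/
abbrev x₁ : Fin 4 := 0

/-- The index of the variable `x_2`. -/
abbrev x₂ : Fin 4 := 1

/-- The index of the variable `x_3`. -/
abbrev x₃ : Fin 4 := 2

/-- The index of the variable `x_4`. -/
abbrev x₄ : Fin 4 := 3

theorem lieDelta_J : lieDelta (J K) (gen K x₁) = 0 ∧ lieDelta (J K) (gen K x₂) = gen K x₁ ∧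
    lieDelta (J K) (gen K x₃) = gen K x₂ ∧ lieDelta (J K) (gen K x₄) = gen K x₃ := by
  simp [lieDelta, lieDer_gen, J, Fin.sum_univ_four, x₁, x₂, x₃, x₄]

theorem polyDelta_J : polyDelta (J K) (MvPolynomial.X x₁) = 0 ∧
    polyDelta (J K) (MvPolynomial.X x₂) = MvPolynomial.X x₁ ∧
    polyDelta (J K) (MvPolynomial.X x₃) = MvPolynomial.X x₂ ∧
    polyDelta (J K) (MvPolynomial.X x₄) = MvPolynomial.X x₃ := by
  simp [polyDelta, J, Fin.sum_univ_four, x₁, x₂, x₃, x₄]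

open MvPolynomial in
/-- The polynomial `f_1`. -/
def f₁ : MvPolynomial (Fin 4) K := X x₁

open MvPolynomial in
/-- The polynomial `f_2`. -/
def f₂ : MvPolynomial (Fin 4) K := X x₂ ^ 2 - 2 * X x₁ * X x₃

open MvPolynomial in
/-- The polynomial `f_3`. -/
def f₃ : MvPolynomial (Fin 4) K :=
  X x₂ ^ 3 - 3 * X x₁ * X x₂ * X x₃ + 3 * X x₁ ^ 2 * X x₄

open MvPolynomial in
/-- The polynomial `f_4`. -/
def f₄ : MvPolynomial (Fin 4) K :=
  X x₂ ^ 2 * X x₃ ^ 2 - 2 * X x₂ ^ 3 * X x₄ + 6 * X x₁ * X x₂ * X x₃ * X x₄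
    - C (8 / 3) * X x₁ * X x₃ ^ 3 - 3 * X x₁ ^ 2 * X x₄ ^ 2

/-- The element `c_1`. -/
def c₁ : CommutatorIdeal K (Fin 4) :=
  com K x₂ x₁ []

/-- The element `c_2`. -/
def c₂ : CommutatorIdeal K (Fin 4) :=
  com K x₄ x₁ [] - com K x₃ x₂ []

/-- The element `c_3`. -/
def c₃ : CommutatorIdeal K (Fin 4) :=
  com K x₃ x₁ [x₁] - com K x₂ x₁ [x₂]

/-- The element `c_4`. -/
def c₄ : CommutatorIdeal K (Fin 4) :=
  (3 : K) • com K x₂ x₁ [x₄] - (2 : K) • com K x₃ x₁ [x₃] + com K x₃ x₂ [x₂]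

/-- The element `c_5`. -/
def c₅ : CommutatorIdeal K (Fin 4) :=
  -((3 : K) • com K x₃ x₁ [x₁, x₄]) + (3 : K) • com K x₂ x₁ [x₂, x₄]
    + (3 : K) • com K x₃ x₁ [x₂, x₃] - (4 : K) • com K x₂ x₁ [x₃, x₃] - com K x₃ x₂ [x₂, x₂]

/-- The element `c_6`. -/
def c₆ : CommutatorIdeal K (Fin 4) :=
  -((9 : K) • com K x₂ x₁ [x₁, x₄, x₄]) + (18 : K) • com K x₃ x₁ [x₁, x₃, x₄]
    - (12 : K) • com K x₄ x₁ [x₁, x₃, x₃] - (9 : K) • com K x₃ x₁ [x₂, x₂, x₄]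
    + (12 : K) • com K x₄ x₁ [x₂, x₂, x₃] + (4 : K) • com K x₂ x₁ [x₃, x₃, x₃]
    - (6 : K) • com K x₃ x₁ [x₂, x₃, x₃] - (3 : K) • com K x₄ x₂ [x₂, x₂, x₂]
    + (3 : K) • com K x₃ x₂ [x₂, x₂, x₃]

/-- The element `c_7`. -/
def c₇ : CommutatorIdeal K (Fin 4) :=
  -((18 : K) • com K x₃ x₁ [x₁, x₁, x₄, x₄]) + (18 : K) • com K x₄ x₁ [x₁, x₁, x₃, x₄]
    + (18 : K) • com K x₂ x₁ [x₁, x₂, x₄, x₄] - (9 : K) • com K x₄ x₁ [x₁, x₂, x₂, x₄]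
    - (18 : K) • com K x₂ x₁ [x₁, x₃, x₃, x₄] + (18 : K) • com K x₃ x₁ [x₁, x₂, x₃, x₄]
    - (18 : K) • com K x₄ x₁ [x₁, x₂, x₃, x₃] + (8 : K) • com K x₃ x₁ [x₁, x₃, x₃, x₃]
    - (9 : K) • com K x₂ x₁ [x₂, x₂, x₃, x₄] - (3 : K) • com K x₃ x₁ [x₂, x₂, x₂, x₄]
    + (15 : K) • com K x₄ x₁ [x₂, x₂, x₂, x₃] + (10 : K) • com K x₂ x₁ [x₂, x₃, x₃, x₃]
    - (12 : K) • com K x₃ x₁ [x₂, x₂, x₃, x₃] - (3 : K) • com K x₄ x₂ [x₂, x₂, x₂, x₂]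
    + (3 : K) • com K x₃ x₂ [x₂, x₂, x₂, x₃]

/-- The family `c_1, …, c_7`; the value at the index `j` is `c_{j+1}`. -/
def c : Fin 7 → CommutatorIdeal K (Fin 4) :=
  ![c₁ K, c₂ K, c₃ K, c₄ K, c₅ K, c₆ K, c₇ K]

/-- The family consisting of
* `c_j f_1^q f_2^r f_4^s` with `j = 1, 3, 4, 5` and `q, r, s ≥ 0`;
* `c_j f_2^r f_4^s` with `j = 6, 7` and `r, s ≥ 0`;
* `c_2 f_1^q f_2^r f_3^e f_4^s` with `q, r, s ≥ 0` and `e = 0, 1`. -/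
def basisC : (Fin 4 × ℕ × ℕ × ℕ) ⊕ (Fin 2 × ℕ × ℕ) ⊕ (ℕ × ℕ × Fin 2 × ℕ) →
    CommutatorIdeal K (Fin 4)
  | .inl (j, q, r, s) => (f₁ K ^ q * f₂ K ^ r * f₄ K ^ s) • ![c₁ K, c₃ K, c₄ K, c₅ K] j
  | .inr (.inl (j, r, s)) => (f₂ K ^ r * f₄ K ^ s) • ![c₆ K, c₇ K] j
  | .inr (.inr (q, r, e, s)) => (f₁ K ^ q * f₂ K ^ r * f₃ K ^ (e : ℕ) * f₄ K ^ s) • c₂ K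

/-- The set consisting of `x_1`, of all `c_j f_2^r f_4^s` with `j = 1, …, 7` and `r, s ≥ 0`, and
of all `c_2 f_2^r f_3 f_4^s` with `r, s ≥ 0`. -/
def algGens : Set (FreeMetabelian K (Fin 4)) :=
  {gen K x₁}
    ∪ {w | ∃ (j : Fin 7) (r s : ℕ),
        w = (((f₂ K ^ r * f₄ K ^ s) • c K j : CommutatorIdeal K (Fin 4)) :
          FreeMetabelian K (Fin 4))}
    ∪ {w | ∃ r s : ℕ,
        w = (((f₂ K ^ r * f₃ K * f₄ K ^ s) • c₂ K : CommutatorIdeal K (Fin 4)) :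
          FreeMetabelian K (Fin 4))}

end FreeMetab

end

/-!
The constants of `δ = δ(3)` in the commutator ideal `L' / L''` of the free metabelian Lie algebra
of rank four are computed by localizing at the constant `x_1` and then undoing the localization.

*Coordinates.* The homomorphism `x_i ↦ (a_i, x_i)` into the split extension `K[X]^4 ⋊ K[X]` induces
a `K[X]`-linear map `L' / L'' → K[X]^4` with `[x_i, x_j] ↦ a_i x_j - a_j x_i`. It is injective
(`fox_injective`): the Jacobi identity brings every element into a normal form in which the
coefficient of `[x_i, x_j]`, `i > j`, does not involve the variables before `x_j`, and such a
combination can be read off from its coordinates. Hence the relations between the `c_j` are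
polynomial identities, and constancy is a system of four polynomial equations (`mem_commConst_iff`).

*Localization.* After inverting `x_1`, the commutator ideal becomes free on `c_1`, `c_2`, `c_3`
(`exists_pow_smul_eq`), so the coefficients of a constant are constants. In `K[X, 1 / x_1]` one may
replace `x_3`, `x_4` by `f_2`, `f_3`; then `δ = x_1 ∂ / ∂x_2`, and its constants are the polynomials
in `f_1^{±1}`, `f_2`, `f_3` (`exists_pow_mul_mem_fAlg`). So every constant `u` of the commutator
ideal satisfies `u x_1^k ∈ N`, where `N` is the span of the proposed basis, which the relations show
to be a module over `K[f_1, …, f_4]` (`fAlg_smul_mem`).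

*Saturation.* It remains to see that `u x_1 ∈ N` implies `u ∈ N` (`mem_of_f₁_smul_mem`). Modulo
`N x_1` the element `u x_1` is a combination of `c_1, …, c_7`, `c_2 f_3` over `K[f_2, f_4]` that
vanishes for `x_1 = 0`. Putting also `x_3 = 0`, where `f_2` and `f_4` become the independent
polynomials `x_2²` and `-2 x_2³ x_4`, and separating even and odd parts under
`(x_2, x_4) ↦ (-x_2, -x_4)`, one finds that all such combinations come from the two relations for
`c_6 f_1` and `c_7 f_1` (`gens_relations`); so they lie in `N x_1`.

The same specialization and parity argument gives linear independence (`linearIndependent_basisC`).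
Finally, a constant of the whole algebra is a multiple of `x_1` plus a constant of the commutator
ideal, and multiplication by `f_1` there is the bracket with `x_1` (`lieSpan_algGens`).
-/

noncomputable section

namespace FreeMetab

open MvPolynomial

section

/-! ### Generators of the commutator ideal -/

section Generators

variable (K : Type*) [Field K] (ι : Type*)

/-- The `K[X]`-submodule of `L' / L''` generated by the commutators `[x_i, x_j]`. -/
def comSpan : Submodule (MvPolynomial ι K) (CommutatorIdeal K ι) :=
  Submodule.span _ (Set.range fun p : ι × ι => com K p.1 p.2 [])

variable {K ι}

theorem lie_gen_mem_comSpan {s : CommutatorIdeal K ι} (hs : s ∈ comSpan K ι)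
    {g : FreeMetabelian K ι} (hg : g ∈ Submodule.span K (Set.range (gen K : ι → _))) :
    ∃ t ∈ comSpan K ι, (t : FreeMetabelian K ι) = ⁅(s : FreeMetabelian K ι), g⁆ := by
  induction hg using Submodule.span_induction with
  | mem x hx =>
    obtain ⟨i, rfl⟩ := hx
    exact ⟨(X i : MvPolynomial ι K) • s, Submodule.smul_mem _ _ hs, by rw [X_smul]; rfl⟩
  | zero => exact ⟨0, zero_mem _, by simp⟩
  | add x y _ _ hx hy =>
    obtain ⟨t, ht, h⟩ := hx
    obtain ⟨t', ht', h'⟩ := hy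
    exact ⟨t + t', add_mem ht ht', by rw [lie_add, ← h, ← h']; rfl⟩
  | smul r x _ hx =>
    obtain ⟨t, ht, h⟩ := hx
    exact ⟨(C r : MvPolynomial ι K) • t, Submodule.smul_mem _ _ ht, by
      rw [lie_smul, ← h, C_smul]; rfl⟩

theorem gen_lie_gen_mem_comSpan {g h : FreeMetabelian K ι}
    (hg : g ∈ Submodule.span K (Set.range (gen K : ι → _)))
    (hh : h ∈ Submodule.span K (Set.range (gen K : ι → _))) :
    ∃ t ∈ comSpan K ι, (t : FreeMetabelian K ι) = ⁅g, h⁆ := by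
  induction hg, hh using Submodule.span_induction₂ with
  | mem_mem x y hx hy =>
    obtain ⟨i, rfl⟩ := hx
    obtain ⟨j, rfl⟩ := hy
    exact ⟨com K i j [], Submodule.subset_span ⟨(i, j), rfl⟩, rfl⟩
  | zero_left y hy => exact ⟨0, zero_mem _, by simp⟩
  | zero_right x hx => exact ⟨0, zero_mem _, by simp⟩
  | add_left x y z _ _ _ hx hy =>
    obtain ⟨t, ht, h⟩ := hx
    obtain ⟨t', ht', h'⟩ := hy
    exact ⟨t + t', add_mem ht ht', by rw [add_lie, ← h, ← h']; rfl⟩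
  | add_right x y z _ _ _ hx hy =>
    obtain ⟨t, ht, h⟩ := hx
    obtain ⟨t', ht', h'⟩ := hy
    exact ⟨t + t', add_mem ht ht', by rw [lie_add, ← h, ← h']; rfl⟩
  | smul_left r x y _ _ hx =>
    obtain ⟨t, ht, h⟩ := hx
    exact ⟨(C r : MvPolynomial ι K) • t, Submodule.smul_mem _ _ ht, by
      rw [smul_lie, ← h, C_smul]; rfl⟩
  | smul_right r x y _ _ hx =>
    obtain ⟨t, ht, h⟩ := hx
    exact ⟨(C r : MvPolynomial ι K) • t, Submodule.smul_mem _ _ ht, by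
      rw [lie_smul, ← h, C_smul]; rfl⟩

theorem lie_mem_comSpan {g h : FreeMetabelian K ι}
    (hg : g ∈ Submodule.span K (Set.range (gen K : ι → _)))
    (hh : h ∈ Submodule.span K (Set.range (gen K : ι → _)))
    {s t : CommutatorIdeal K ι} (hs : s ∈ comSpan K ι) (ht : t ∈ comSpan K ι) :
    ∃ w ∈ comSpan K ι, (w : FreeMetabelian K ι) = ⁅g + s, h + t⁆ := by
  obtain ⟨a, ha, ha'⟩ := gen_lie_gen_mem_comSpan hg hh
  obtain ⟨b, hb, hb'⟩ := lie_gen_mem_comSpan hs hh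
  obtain ⟨d, hd, hd'⟩ := lie_gen_mem_comSpan ht hg
  refine ⟨a - d + b, add_mem (sub_mem ha hd) hb, ?_⟩
  rw [add_lie, lie_add, lie_add, lie_eq_zero K s.2 t.2, add_zero, ← ha', ← hb',
    ← lie_skew g, ← hd', ← sub_eq_add_neg]
  rfl

variable (K ι) in
/-- The elements that are a linear form in the generators plus an element of the submodule
generated by the `[x_i, x_j]`; this subalgebra is everything. -/
def linAddComSpan : LieSubalgebra K (FreeMetabelian K ι) where
  carrier := {u | ∃ g ∈ Submodule.span K (Set.range (gen K : ι → _)), ∃ s ∈ comSpan K ι,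
    u = g + (s : FreeMetabelian K ι)}
  add_mem' := by
    rintro _ _ ⟨g, hg, s, hs, rfl⟩ ⟨h, hh, t, ht, rfl⟩
    exact ⟨g + h, add_mem hg hh, s + t, add_mem hs ht, by
      rw [LieSubmodule.coe_add]; abel⟩
  zero_mem' := ⟨0, zero_mem _, 0, zero_mem _, by simp⟩
  smul_mem' := by
    rintro r _ ⟨g, hg, s, hs, rfl⟩
    exact ⟨r • g, Submodule.smul_mem _ _ hg, (C r : MvPolynomial ι K) • s,
      Submodule.smul_mem _ _ hs, by rw [C_smul, smul_add]; rfl⟩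
  lie_mem' := by
    rintro _ _ ⟨g, hg, s, hs, rfl⟩ ⟨h, hh, t, ht, rfl⟩
    obtain ⟨w, hw, h⟩ := lie_mem_comSpan hg hh hs ht
    exact ⟨0, zero_mem _, w, hw, by rw [zero_add, h]⟩

theorem exists_eq_gen_add_com (u : FreeMetabelian K ι) :
    ∃ g ∈ Submodule.span K (Set.range (gen K : ι → _)), ∃ s ∈ comSpan K ι,
      u = g + (s : FreeMetabelian K ι) := by
  have hgen (i : ι) : gen K i ∈ linAddComSpan K ι :=
    ⟨gen K i, Submodule.subset_span ⟨i, rfl⟩, 0, zero_mem _, by simp⟩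
  -- The projection `L → L / L''` factors through the subalgebra, as `L` is free.
  let f : FreeLieAlgebra K ι →ₗ⁅K⁆ linAddComSpan K ι :=
    FreeLieAlgebra.lift K fun i => ⟨gen K i, hgen i⟩
  have hf : (linAddComSpan K ι).incl.comp f = proj K ι := FreeLieAlgebra.hom_ext fun i => by
    rw [LieHom.comp_apply, FreeLieAlgebra.lift_of_apply]; rfl
  obtain ⟨a, rfl⟩ := proj_surjective K u
  rw [← hf]
  exact (f a).2

theorem comSpan_eq_top : comSpan K ι = ⊤ := by
  refine Submodule.eq_top_iff'.2 fun u => ?_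
  suffices h : ∃ s ∈ comSpan K ι, (s : FreeMetabelian K ι) = u by
    obtain ⟨s, hs, h⟩ := h
    rwa [← Subtype.ext h]
  obtain ⟨u, hu⟩ := u
  change ∃ s ∈ comSpan K ι, (s : FreeMetabelian K ι) = u
  rw [derivedSeries_succ K 0, ← LieSubmodule.mem_toSubmodule,
    LieSubmodule.lieIdeal_oper_eq_linear_span'] at hu
  induction hu using Submodule.span_induction with
  | mem x hx =>
    obtain ⟨m, -, n, -, rfl⟩ := hx
    obtain ⟨g, hg, s, hs, rfl⟩ := exists_eq_gen_add_com m
    obtain ⟨h, hh, t, ht, rfl⟩ := exists_eq_gen_add_com n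
    exact lie_mem_comSpan hg hh hs ht
  | zero => exact ⟨0, zero_mem _, rfl⟩
  | add x y _ _ hx hy =>
    obtain ⟨s, hs, rfl⟩ := hx
    obtain ⟨t, ht, rfl⟩ := hy
    exact ⟨s + t, add_mem hs ht, rfl⟩
  | smul r x _ hx =>
    obtain ⟨s, hs, rfl⟩ := hx
    exact ⟨(C r : MvPolynomial ι K) • s, Submodule.smul_mem _ _ hs, by rw [C_smul]; rfl⟩

end Generators

/-! ### The Magnus embedding -/

variable (K : Type*) [Field K] {ι : Type*}

/-- The metabelian Lie algebra `K[X]^ι ⋊ K[X]`, where the abelian Lie algebra `K[X]` acts on the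
abelian ideal `K[X]^ι` by multiplication from the right. -/
@[ext] structure Magnus (ι : Type*) where
  vec : ι → MvPolynomial ι K
  pol : MvPolynomial ι K

namespace Magnus

/-- The identification with pairs. -/
def toProd : Magnus K ι ≃ (ι → MvPolynomial ι K) × MvPolynomial ι K where
  toFun a := (a.vec, a.pol)
  invFun a := ⟨a.1, a.2⟩
  left_inv _ := rfl
  right_inv _ := rfl

instance : AddCommGroup (Magnus K ι) := (toProd K).addCommGroup

instance : Module K (Magnus K ι) := (toProd K).module K

variable {K}

@[simp] theorem vec_add (a b : Magnus K ι) : (a + b).vec = a.vec + b.vec := rfl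
@[simp] theorem pol_add (a b : Magnus K ι) : (a + b).pol = a.pol + b.pol := rfl
@[simp] theorem vec_zero : (0 : Magnus K ι).vec = 0 := rfl
@[simp] theorem pol_zero : (0 : Magnus K ι).pol = 0 := rfl
@[simp] theorem vec_smul (r : K) (a : Magnus K ι) : (r • a).vec = r • a.vec := rfl
@[simp] theorem pol_smul (r : K) (a : Magnus K ι) : (r • a).pol = r • a.pol := rfl

instance : Bracket (Magnus K ι) (Magnus K ι) where
  bracket a b := ⟨b.pol • a.vec - a.pol • b.vec, 0⟩

@[simp] theorem vec_lie (a b : Magnus K ι) :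
    ⁅a, b⁆.vec = b.pol • a.vec - a.pol • b.vec := rfl
@[simp] theorem pol_lie (a b : Magnus K ι) : ⁅a, b⁆.pol = 0 := rfl

instance : LieRing (Magnus K ι) where
  add_lie a b c := by
    apply Magnus.ext
    · simp only [vec_lie, vec_add, pol_add, smul_add, add_smul]; abel
    · simp
  lie_add a b c := by
    apply Magnus.ext
    · simp only [vec_lie, vec_add, pol_add, smul_add, add_smul]; abel
    · simp
  lie_self a := by
    apply Magnus.ext <;> simp
  leibniz_lie a b c := by
    apply Magnus.ext
    · funext i
      simp only [vec_lie, vec_add, pol_lie, Pi.add_apply, Pi.sub_apply, Pi.smul_apply, smul_eq_mul]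
      ring
    · simp

instance : LieAlgebra K (Magnus K ι) where
  lie_smul r a b := by
    apply Magnus.ext
    · simp only [vec_lie, vec_smul, pol_smul, smul_sub, smul_assoc, smul_comm a.pol r]
    · simp

theorem pol_eq_zero {a : Magnus K ι} (ha : a ∈ LieAlgebra.derivedSeries K (Magnus K ι) 1) :
    a.pol = 0 := by
  rw [derivedSeries_succ K 0, ← LieSubmodule.mem_toSubmodule,
    LieSubmodule.lieIdeal_oper_eq_linear_span'] at ha
  induction ha using Submodule.span_induction with
  | mem x hx =>
    obtain ⟨m, -, n, -, rfl⟩ := hx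
    rfl
  | zero => rfl
  | add x y _ _ hx hy => rw [pol_add, hx, hy, add_zero]
  | smul r x _ hx => rw [pol_smul, hx, smul_zero]

theorem derivedSeries_two : LieAlgebra.derivedSeries K (Magnus K ι) 2 = ⊥ := by
  rw [derivedSeries_succ K 1, LieSubmodule.lie_eq_bot_iff]
  intro a ha b hb
  apply Magnus.ext <;> simp [pol_eq_zero ha, pol_eq_zero hb]

end Magnus

open Classical in
/-- The homomorphism `L → K[X]^ι ⋊ K[X]` with `x_i ↦ (a_i, x_i)`, where the `a_i` form the
standard basis of `K[X]^ι`. -/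
def freeMagnus (ι : Type*) : FreeLieAlgebra K ι →ₗ⁅K⁆ Magnus K ι :=
  FreeLieAlgebra.lift K fun i => ⟨Pi.single i 1, X i⟩

theorem freeMagnus_eq_zero {a : FreeLieAlgebra K ι}
    (ha : a ∈ LieAlgebra.derivedSeries K (FreeLieAlgebra K ι) 2) : freeMagnus K ι a = 0 := by
  have h := LieIdeal.derivedSeries_map_le (R := K) (f := freeMagnus K ι) 2 (LieIdeal.mem_map ha)
  rw [Magnus.derivedSeries_two] at h
  simpa using h

/-- The linear map underlying the homomorphism `L / L'' → K[X]^ι ⋊ K[X]` induced by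
`x_i ↦ (a_i, x_i)`. -/
def magnus (ι : Type*) : FreeMetabelian K ι →ₗ[K] Magnus K ι :=
  Submodule.liftQ (LieAlgebra.derivedSeries K (FreeLieAlgebra K ι) 2).toSubmodule
    (freeMagnus K ι : FreeLieAlgebra K ι →ₗ[K] Magnus K ι) fun _ ha => freeMagnus_eq_zero K ha

theorem magnus_proj (a : FreeLieAlgebra K ι) : magnus K ι (proj K ι a) = freeMagnus K ι a := rfl

theorem magnus_lie (a b : FreeMetabelian K ι) :
    magnus K ι ⁅a, b⁆ = ⁅magnus K ι a, magnus K ι b⁆ := by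
  obtain ⟨a, rfl⟩ := proj_surjective K a
  obtain ⟨b, rfl⟩ := proj_surjective K b
  rw [← LieHom.map_lie, magnus_proj, magnus_proj, magnus_proj, LieHom.map_lie]

open Classical in
theorem magnus_gen (i : ι) : magnus K ι (gen K i) = ⟨Pi.single i 1, X i⟩ := by
  rw [gen, magnus_proj, freeMagnus, FreeLieAlgebra.lift_of_apply]

theorem magnus_pol_eq_zero {u : FreeMetabelian K ι}
    (hu : u ∈ LieAlgebra.derivedSeries K (FreeMetabelian K ι) 1) : (magnus K ι u).pol = 0 := by
  rw [derivedSeries_succ K 0, ← LieSubmodule.mem_toSubmodule,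
    LieSubmodule.lieIdeal_oper_eq_linear_span'] at hu
  induction hu using Submodule.span_induction with
  | mem x hx =>
    obtain ⟨m, -, n, -, rfl⟩ := hx
    rw [magnus_lie]; rfl
  | zero => rw [map_zero]; rfl
  | add x y _ _ hx hy => rw [map_add, Magnus.pol_add, hx, hy, add_zero]
  | smul r x _ hx => rw [map_smul, Magnus.pol_smul, hx, smul_zero]

/-- The `K[X]`-linear map `L' / L'' → K[X]^ι` with `[x_i, x_j] ↦ a_i x_j - a_j x_i`. -/
def fox (ι : Type*) : CommutatorIdeal K ι →ₗ[MvPolynomial ι K] (ι → MvPolynomial ι K) where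
  toFun u := (magnus K ι u).vec
  map_add' u v := by rw [LieSubmodule.coe_add, map_add, Magnus.vec_add]
  map_smul' p u := by
    rw [RingHom.id_apply]
    induction p using MvPolynomial.induction_on generalizing u with
    | C a =>
      rw [C_smul, LieSubmodule.coe_smul, map_smul, Magnus.vec_smul, ← algebraMap_eq,
        algebraMap_smul]
    | add p q hp hq =>
      rw [add_smul, add_smul, LieSubmodule.coe_add, map_add, Magnus.vec_add, hp, hq]
    | mul_X p j hp =>
      rw [mul_smul, hp, X_smul, mul_smul]
      congr 1
      change (magnus K ι ⁅(u : FreeMetabelian K ι), gen K j⁆).vec = _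
      rw [magnus_lie, magnus_gen, Magnus.vec_lie, magnus_pol_eq_zero K u.2, zero_smul, sub_zero]

theorem fox_com [DecidableEq ι] (i j k : ι) : fox K ι (com K i j []) k
    = (if k = i then X j else 0) - (if k = j then X i else 0) := by
  change (magnus K ι ⁅gen K i, gen K j⁆).vec k = _
  rw [magnus_lie, magnus_gen, magnus_gen, Magnus.vec_lie]
  simp [Pi.single_apply]

end

section

variable {K : Type*} [Field K] {ι : Type*}

/-! ### Commutators and the derivation in coordinates -/

theorem com_eq_prod_smul (i j : ι) (l : List ι) :
    com K i j l = (l.map (X : ι → MvPolynomial ι K)).prod • com K i j [] := by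
  induction l using List.reverseRecOn with
  | nil => simp
  | append_singleton l k ih =>
    rw [List.map_append, List.prod_append, mul_comm, mul_smul, ← ih]
    simp [com, X_smul]

theorem fox_com_list [DecidableEq ι] (i j k : ι) (l : List ι) : fox K ι (com K i j l) k
    = (l.map X).prod * ((if k = i then X j else 0) - (if k = j then X i else 0)) := by
  rw [com_eq_prod_smul, map_smul, Pi.smul_apply, fox_com, smul_eq_mul]

theorem com_swap (i j : ι) : com K i j [] = -com K j i [] :=
  Subtype.ext (lie_skew _ _).symm

theorem com_self (i : ι) : com K i i [] = 0 :=
  Subtype.ext (lie_self _)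

theorem com_jacobi (i j k : ι) : (X k : MvPolynomial ι K) • com K i j []
    + (X i : MvPolynomial ι K) • com K j k [] + (X j : MvPolynomial ι K) • com K k i [] = 0 := by
  rw [X_smul, X_smul, X_smul]
  apply Subtype.ext
  change ⁅⁅gen K i, gen K j⁆, gen K k⁆ + ⁅⁅gen K j, gen K k⁆, gen K i⁆
    + ⁅⁅gen K k, gen K i⁆, gen K j⁆ = 0
  rw [← lie_skew ⁅gen K i, gen K j⁆, ← lie_skew ⁅gen K j, gen K k⁆, ← lie_skew ⁅gen K k, gen K i⁆,
    ← neg_add, ← neg_add, neg_eq_zero, ← lie_jacobi (gen K i) (gen K j) (gen K k)]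
  abel

theorem commDelta_com [Fintype ι] (α : Matrix ι ι K) (i j : ι) :
    commDelta α (com K i j []) = ∑ l, α l j • com K i l [] + ∑ l, α l i • com K l j [] := by
  apply Subtype.ext
  have h (i : ι) : lieDelta α (gen K i) = ∑ l, α l i • gen K l := lieDer_gen _ i
  change lieDelta α ⁅gen K i, gen K j⁆ = _
  rw [LieDerivation.apply_lie_eq_add, h, h, lie_sum, sum_lie]
  simp only [lie_smul, smul_lie]
  simp [com]

/-- The derivation of `K[X]^ι` that corresponds to `δ` maps the basis vector `a_j` to
`∑ i, α_{ij} a_i`. -/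
theorem fox_commDelta [Fintype ι] (α : Matrix ι ι K) (u : CommutatorIdeal K ι) (k : ι) :
    fox K ι (commDelta α u) k = polyDelta α (fox K ι u k) + ∑ j, α k j • fox K ι u j := by
  classical
  have hu : u ∈ comSpan K ι := by rw [comSpan_eq_top]; trivial
  induction hu using Submodule.span_induction with
  | mem x hx =>
    obtain ⟨⟨i, j⟩, rfl⟩ := hx
    have h (j : ι) : polyDelta α (X j) = ∑ i, α i j • X i := mkDerivation_X _ _ _
    have h' (p : Prop) [Decidable p] (f : MvPolynomial ι K) :
        polyDelta α (if p then f else 0) = if p then polyDelta α f else 0 := by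
      split_ifs <;> simp
    change fox K ι (commDelta α (com K i j [])) k = polyDelta α (fox K ι (com K i j []) k)
      + ∑ l, α k l • fox K ι (com K i j []) l
    simp only [commDelta_com, map_add, map_sum, LinearMap.map_smul_of_tower, Pi.add_apply,
      Finset.sum_apply, Pi.smul_apply, fox_com, map_sub, h', h, smul_sub, smul_ite, smul_zero,
      Finset.sum_sub_distrib, Finset.sum_ite_eq, Finset.sum_ite_eq', Finset.mem_univ, if_true]
    split_ifs <;> (try simp only [Finset.sum_const_zero]) <;> abel
  | zero => simp
  | add x y _ _ hx hy =>
    simp only [map_add, Pi.add_apply, hx, hy, smul_add, Finset.sum_add_distrib]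
    abel
  | smul p x _ hx =>
    simp only [commDelta_smul, map_add, map_smul, Pi.add_apply, Pi.smul_apply, hx, smul_eq_mul,
      Derivation.leibniz]
    simp only [mul_add, Finset.mul_sum, mul_smul_comm]
    ring

theorem sub_aeval_mem {σ : Type*} (I : Ideal (MvPolynomial σ K)) (v : σ → MvPolynomial σ K)
    (h : ∀ i, X i - v i ∈ I) (p : MvPolynomial σ K) : p - aeval v p ∈ I := by
  induction p using MvPolynomial.induction_on with
  | C a => simp [← algebraMap_eq]
  | add p q hp hq =>
    rw [map_add, add_sub_add_comm]
    exact add_mem hp hq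
  | mul_X p i hp =>
    have e : p * X i - aeval v p * v i = p * (X i - v i) + (p - aeval v p) * v i := by ring
    rw [map_mul, aeval_X, e]
    exact add_mem (I.mul_mem_left _ (h i)) (I.mul_mem_right _ hp)

end

section

variable {K : Type*} [Field K]

/-! ### Injectivity of the Magnus embedding in rank four -/

theorem exists_com_combination (u : CommutatorIdeal K (Fin 4)) :
    ∃ p₂₁ p₃₁ p₄₁ p₃₂ p₄₂ p₄₃ : MvPolynomial (Fin 4) K,
      u = p₂₁ • com K (1 : Fin 4) 0 [] + p₃₁ • com K (2 : Fin 4) 0 [] + p₄₁ • com K (3 : Fin 4) 0 []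
        + p₃₂ • com K (2 : Fin 4) 1 [] + p₄₂ • com K (3 : Fin 4) 1 []
        + p₄₃ • com K (3 : Fin 4) 2 [] := by
  let e : Fin 6 → CommutatorIdeal K (Fin 4) :=
    ![com K (1 : Fin 4) 0 [], com K (2 : Fin 4) 0 [], com K (3 : Fin 4) 0 [],
      com K (2 : Fin 4) 1 [], com K (3 : Fin 4) 1 [], com K (3 : Fin 4) 2 []]
  have he (i : Fin 6) : e i ∈ Submodule.span (MvPolynomial (Fin 4) K) (Set.range e) :=
    Submodule.subset_span ⟨i, rfl⟩
  have h : comSpan K (Fin 4) ≤ Submodule.span (MvPolynomial (Fin 4) K) (Set.range e) := by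
    refine Submodule.span_le.2 ?_
    rintro _ ⟨⟨i, j⟩, rfl⟩
    -- `[x_i, x_j]` with `i > j` is a member of the family.
    have key : ∀ i j : Fin 4, j < i →
        com K i j [] ∈ Submodule.span (MvPolynomial (Fin 4) K) (Set.range e) := by
      intro i j hij
      fin_cases i <;> fin_cases j <;> first
        | exact absurd hij (by decide)
        | exact he 0
        | exact he 1
        | exact he 2
        | exact he 3
        | exact he 4
        | exact he 5
    change com K i j [] ∈ _
    rcases lt_trichotomy i j with hij | rfl | hij
    · rw [com_swap]
      exact neg_mem (key j i hij)
    · rw [com_self]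
      exact zero_mem _
    · exact key i j hij
  have hu : u ∈ comSpan K (Fin 4) := by rw [comSpan_eq_top]; trivial
  obtain ⟨q, rfl⟩ := (Submodule.mem_span_range_iff_exists_fun _).1 (h hu)
  exact ⟨q 0, q 1, q 2, q 3, q 4, q 5, by simp [Fin.sum_univ_six, e]⟩

variable (K) in
/-- The substitution `x_1 = 0`. -/
def killOne : MvPolynomial (Fin 4) K →ₐ[K] MvPolynomial (Fin 4) K :=
  aeval ![0, X 1, X 2, X 3]

variable (K) in
/-- The substitution `x_1 = x_2 = 0`. -/
def killTwo : MvPolynomial (Fin 4) K →ₐ[K] MvPolynomial (Fin 4) K :=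
  aeval ![0, 0, X 2, X 3]

theorem killOne_killOne (p : MvPolynomial (Fin 4) K) :
    killOne K (killOne K p) = killOne K p := by
  have h : (killOne K).comp (killOne K) = killOne K :=
    algHom_ext fun i => by fin_cases i <;> simp [killOne]
  exact AlgHom.congr_fun h p

theorem killTwo_killTwo (p : MvPolynomial (Fin 4) K) :
    killTwo K (killTwo K p) = killTwo K p := by
  have h : (killTwo K).comp (killTwo K) = killTwo K :=
    algHom_ext fun i => by fin_cases i <;> simp [killTwo]
  exact AlgHom.congr_fun h p

theorem exists_eq_killOne_add (p : MvPolynomial (Fin 4) K) :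
    ∃ q, p = killOne K p + q * X 0 := by
  have h : p - killOne K p ∈ Ideal.span {(X 0 : MvPolynomial (Fin 4) K)} :=
    sub_aeval_mem _ _ (fun i => by fin_cases i <;> simp) p
  obtain ⟨q, hq⟩ := Ideal.mem_span_singleton'.1 h
  exact ⟨q, by rw [hq]; ring⟩

theorem exists_eq_killTwo_add (p : MvPolynomial (Fin 4) K) :
    ∃ q r, p = killTwo K p + q * X 0 + r * X 1 := by
  have h : p - killTwo K p ∈ Ideal.span {(X 0 : MvPolynomial (Fin 4) K), X 1} := by
    refine sub_aeval_mem _ _ (fun i => ?_) p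
    have h₀ : (X 0 : MvPolynomial (Fin 4) K) ∈ Ideal.span {(X 0 : MvPolynomial (Fin 4) K), X 1} :=
      Ideal.subset_span (by simp)
    have h₁ : (X 1 : MvPolynomial (Fin 4) K) ∈ Ideal.span {(X 0 : MvPolynomial (Fin 4) K), X 1} :=
      Ideal.subset_span (by simp)
    fin_cases i <;> simp [h₀, h₁]
  obtain ⟨q, r, hq⟩ := Ideal.mem_span_pair.1 h
  exact ⟨q, r, by linear_combination -hq⟩

/-- Every element of the commutator ideal is a combination of the `[x_i, x_j]` with `i > j` in
which the coefficient of `[x_i, x_j]` does not involve the variables `x_k` with `k < j`. -/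
theorem exists_normal_form (u : CommutatorIdeal K (Fin 4)) :
    ∃ p₂₁ p₃₁ p₄₁ p₃₂ p₄₂ p₄₃ : MvPolynomial (Fin 4) K,
      killOne K p₃₂ = p₃₂ ∧ killOne K p₄₂ = p₄₂ ∧ killTwo K p₄₃ = p₄₃ ∧
      u = p₂₁ • com K (1 : Fin 4) 0 [] + p₃₁ • com K (2 : Fin 4) 0 [] + p₄₁ • com K (3 : Fin 4) 0 []
        + p₃₂ • com K (2 : Fin 4) 1 [] + p₄₂ • com K (3 : Fin 4) 1 []
        + p₄₃ • com K (3 : Fin 4) 2 [] := by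
  obtain ⟨p₂₁, p₃₁, p₄₁, p₃₂, p₄₂, p₄₃, rfl⟩ := exists_com_combination u
  obtain ⟨q, r, h₄₃⟩ := exists_eq_killTwo_add p₄₃
  obtain ⟨s, h₄₂⟩ := exists_eq_killOne_add (p₄₂ + r * X 2)
  obtain ⟨t, h₃₂⟩ := exists_eq_killOne_add (p₃₂ - r * X 3)
  refine ⟨p₂₁ - t * X 2 - s * X 3, p₃₁ - q * X 3 + t * X 1, p₄₁ + q * X 2 + s * X 1,
    killOne K (p₃₂ - r * X 3), killOne K (p₄₂ + r * X 2), killTwo K p₄₃, killOne_killOne _,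
    killOne_killOne _, killTwo_killTwo _, ?_⟩
  have j₁ := com_jacobi (K := K) (3 : Fin 4) 2 0
  have j₂ := com_jacobi (K := K) (3 : Fin 4) 2 1
  have j₃ := com_jacobi (K := K) (2 : Fin 4) 1 0
  have j₄ := com_jacobi (K := K) (3 : Fin 4) 1 0
  rw [com_swap 0 3] at j₁ j₄
  rw [com_swap 1 3] at j₂
  rw [com_swap 0 2] at j₃
  have e₄₃ : p₄₃ • com K (3 : Fin 4) 2 []
      = (killTwo K p₄₃ + q * X 0 + r * X 1) • com K (3 : Fin 4) 2 [] := by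
    rw [← h₄₃]
  have e₄₂ : (p₄₂ + r * X 2) • com K (3 : Fin 4) 1 []
      = (killOne K (p₄₂ + r * X 2) + s * X 0) • com K (3 : Fin 4) 1 [] := by rw [← h₄₂]
  have e₃₂ : (p₃₂ - r * X 3) • com K (2 : Fin 4) 1 []
      = (killOne K (p₃₂ - r * X 3) + t * X 0) • com K (2 : Fin 4) 1 [] := by rw [← h₃₂]
  linear_combination (norm := module) e₄₃ + e₄₂ + e₃₂ + q • j₁ + r • j₂ + t • j₃ + s • j₄

theorem fox_injective : Function.Injective (fox K (Fin 4)) := by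
  refine (injective_iff_map_eq_zero _).2 fun u hu => ?_
  obtain ⟨p₂₁, p₃₁, p₄₁, p₃₂, p₄₂, p₄₃, h₃₂, h₄₂, h₄₃, rfl⟩ := exists_normal_form u
  have hk (k : Fin 4) := congrFun hu k
  simp only [map_add, map_smul, Pi.add_apply, Pi.smul_apply, fox_com, smul_eq_mul,
    Pi.zero_apply] at hk
  have e₄ : p₄₁ * X 0 + p₄₂ * X 1 + p₄₃ * X 2 = 0 := by simpa using hk 3
  -- Put `x_1 = x_2 = 0`, then `x_1 = 0`.
  have z₄₃ : p₄₃ = 0 := by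
    have := congrArg (killTwo K) e₄
    rw [map_add, map_add, map_mul, map_mul, map_mul, h₄₃] at this
    simpa [killTwo] using this
  subst z₄₃
  have z₄₂ : p₄₂ = 0 := by
    have := congrArg (killOne K) e₄
    rw [map_add, map_add, map_mul, map_mul, h₄₂] at this
    simpa [killOne] using this
  subst z₄₂
  have z₄₁ : p₄₁ = 0 := by simpa using e₄
  subst z₄₁
  have e₃ : p₃₁ * X 0 + p₃₂ * X 1 = 0 := by simpa using hk 2
  have z₃₂ : p₃₂ = 0 := by
    have := congrArg (killOne K) e₃
    rw [map_add, map_mul, map_mul, h₃₂] at this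
    simpa [killOne] using this
  subst z₃₂
  have z₃₁ : p₃₁ = 0 := by simpa using e₃
  subst z₃₁
  have z₂₁ : p₂₁ = 0 := by simpa using hk 1
  subst z₂₁
  simp

end

section

variable (K : Type*) [Field K]

/-! ### The elements `c_j` in coordinates -/

theorem fox_c₁ : fox K (Fin 4) (c₁ K) =
    ![-X 1, X 0, 0, 0] := by
  ext1 i
  fin_cases i <;> simp [c₁, fox_com_list, x₁, x₂, x₃, x₄]

theorem fox_c₂ : fox K (Fin 4) (c₂ K) =
    ![-X 3, X 2, -X 1, X 0] := by
  ext1 i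
  fin_cases i <;> simp [c₂, fox_com_list, x₁, x₂, x₃, x₄]

theorem fox_c₃ : fox K (Fin 4) (c₃ K) =
    ![-X 0 * X 2 + X 1 ^ 2,
      -X 0 * X 1,
      X 0 ^ 2,
      0] := by
  ext1 i
  simp only [c₃, map_add, map_sub, map_neg, LinearMap.map_smul_of_tower, Pi.add_apply, Pi.sub_apply,
    Pi.neg_apply, Pi.smul_apply, fox_com_list, smul_eq_C_mul, map_ofNat C, List.map_cons,
    List.map_nil, List.prod_cons, List.prod_nil]
  fin_cases i <;> simp [x₁, x₂, x₃, x₄] <;> ring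

theorem fox_c₄ : fox K (Fin 4) (c₄ K) =
    ![-3 * X 1 * X 3 + 2 * X 2 ^ 2,
      3 * X 0 * X 3 - X 1 * X 2,
      -2 * X 0 * X 2 + X 1 ^ 2,
      0] := by
  ext1 i
  simp only [c₄, map_add, map_sub, map_neg, LinearMap.map_smul_of_tower, Pi.add_apply, Pi.sub_apply,
    Pi.neg_apply, Pi.smul_apply, fox_com_list, smul_eq_C_mul, map_ofNat C, List.map_cons,
    List.map_nil, List.prod_cons, List.prod_nil]
  fin_cases i <;> simp [x₁, x₂, x₃, x₄] <;> ring

theorem fox_c₅ : fox K (Fin 4) (c₅ K) =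
    ![3 * X 0 * X 2 * X 3 - 3 * X 1 ^ 2 * X 3 + X 1 * X 2 ^ 2,
      3 * X 0 * X 1 * X 3 - 4 * X 0 * X 2 ^ 2 + X 1 ^ 2 * X 2,
      -3 * X 0 ^ 2 * X 3 + 3 * X 0 * X 1 * X 2 - X 1 ^ 3,
      0] := by
  ext1 i
  simp only [c₅, map_add, map_sub, map_neg, LinearMap.map_smul_of_tower, Pi.add_apply, Pi.sub_apply,
    Pi.neg_apply, Pi.smul_apply, fox_com_list, smul_eq_C_mul, map_ofNat C, List.map_cons,
    List.map_nil, List.prod_cons, List.prod_nil]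
  fin_cases i <;> simp [x₁, x₂, x₃, x₄] <;> ring

theorem fox_c₆ : fox K (Fin 4) (c₆ K) =
    ![9 * X 0 * X 1 * X 3 ^ 2 - 6 * X 0 * X 2 ^ 2 * X 3 - 3 * X 1 ^ 2 * X 2 * X 3
        + 2 * X 1 * X 2 ^ 3,
      -9 * X 0 ^ 2 * X 3 ^ 2 + 4 * X 0 * X 2 ^ 3 + 3 * X 1 ^ 3 * X 3 - 3 * X 1 ^ 2 * X 2 ^ 2,
      18 * X 0 ^ 2 * X 2 * X 3 - 9 * X 0 * X 1 ^ 2 * X 3 - 6 * X 0 * X 1 * X 2 ^ 2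
        + 3 * X 1 ^ 3 * X 2,
      -12 * X 0 ^ 2 * X 2 ^ 2 + 12 * X 0 * X 1 ^ 2 * X 2 - 3 * X 1 ^ 4] := by
  ext1 i
  simp only [c₆, map_add, map_sub, map_neg, LinearMap.map_smul_of_tower, Pi.add_apply, Pi.sub_apply,
    Pi.neg_apply, Pi.smul_apply, fox_com_list, smul_eq_C_mul, map_ofNat C, List.map_cons,
    List.map_nil, List.prod_cons, List.prod_nil]
  fin_cases i <;> simp [x₁, x₂, x₃, x₄] <;> ring

theorem fox_c₇ : fox K (Fin 4) (c₇ K) =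
    ![-9 * X 0 * X 1 ^ 2 * X 3 ^ 2 + 18 * X 0 * X 1 * X 2 ^ 2 * X 3 - 8 * X 0 * X 2 ^ 4
        - 3 * X 1 ^ 3 * X 2 * X 3 + 2 * X 1 ^ 2 * X 2 ^ 3,
      18 * X 0 ^ 2 * X 1 * X 3 ^ 2 - 18 * X 0 ^ 2 * X 2 ^ 2 * X 3 - 9 * X 0 * X 1 ^ 2 * X 2 * X 3
        + 10 * X 0 * X 1 * X 2 ^ 3 + 3 * X 1 ^ 4 * X 3 - 3 * X 1 ^ 3 * X 2 ^ 2,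
      -18 * X 0 ^ 3 * X 3 ^ 2 + 18 * X 0 ^ 2 * X 1 * X 2 * X 3 + 8 * X 0 ^ 2 * X 2 ^ 3
        - 3 * X 0 * X 1 ^ 3 * X 3 - 12 * X 0 * X 1 ^ 2 * X 2 ^ 2 + 3 * X 1 ^ 4 * X 2,
      18 * X 0 ^ 3 * X 2 * X 3 - 9 * X 0 ^ 2 * X 1 ^ 2 * X 3 - 18 * X 0 ^ 2 * X 1 * X 2 ^ 2
        + 15 * X 0 * X 1 ^ 3 * X 2 - 3 * X 1 ^ 5] := by
  ext1 i
  simp only [c₇, map_add, map_sub, map_neg, LinearMap.map_smul_of_tower, Pi.add_apply, Pi.sub_apply,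
    Pi.neg_apply, Pi.smul_apply, fox_com_list, smul_eq_C_mul, map_ofNat C, List.map_cons,
    List.map_nil, List.prod_cons, List.prod_nil]
  fin_cases i <;> simp [x₁, x₂, x₃, x₄] <;> ring

/-! ### Constants in coordinates -/

theorem mem_commConst_iff (u : CommutatorIdeal K (Fin 4)) : u ∈ commConst (J K) ↔
    polyDelta (J K) (fox K (Fin 4) u 0) + fox K (Fin 4) u 1 = 0 ∧
    polyDelta (J K) (fox K (Fin 4) u 1) + fox K (Fin 4) u 2 = 0 ∧
    polyDelta (J K) (fox K (Fin 4) u 2) + fox K (Fin 4) u 3 = 0 ∧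
    polyDelta (J K) (fox K (Fin 4) u 3) = 0 := by
  have h : u ∈ commConst (J K) ↔ commDelta (J K) u = 0 :=
    ⟨fun h => Subtype.ext h, fun h => congrArg Subtype.val h⟩
  rw [h, ← fox_injective.eq_iff, map_zero, funext_iff]
  simp [fox_commDelta, J, Fin.sum_univ_four, Fin.forall_fin_succ]

theorem polyDelta_X₁ : polyDelta (J K) (X 0) = 0 := (polyDelta_J K).1
theorem polyDelta_X₂ : polyDelta (J K) (X 1) = X 0 := (polyDelta_J K).2.1
theorem polyDelta_X₃ : polyDelta (J K) (X 2) = X 1 := (polyDelta_J K).2.2.1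
theorem polyDelta_X₄ : polyDelta (J K) (X 3) = X 2 := (polyDelta_J K).2.2.2

theorem polyDelta_ofNat (n : ℕ) [n.AtLeastTwo] :
    polyDelta (J K) (ofNat(n) : MvPolynomial (Fin 4) K) = 0 :=
  Derivation.map_natCast _ n


theorem f₁_mem : f₁ K ∈ polyConst (J K) := polyDelta_X₁ K

theorem f₂_mem : f₂ K ∈ polyConst (J K) := by
  change polyDelta (J K) (f₂ K) = 0
  simp [f₂, Derivation.leibniz, Derivation.leibniz_pow, polyDelta_X₁, polyDelta_X₂, polyDelta_X₃,
    polyDelta_ofNat, x₁, x₂, x₃, x₄]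
  ring

theorem f₃_mem : f₃ K ∈ polyConst (J K) := by
  change polyDelta (J K) (f₃ K) = 0
  simp [f₃, Derivation.leibniz, Derivation.leibniz_pow, polyDelta_X₁, polyDelta_X₂, polyDelta_X₃,
    polyDelta_X₄,
    polyDelta_ofNat, x₁, x₂, x₃, x₄]
  ring

theorem c_mem_commConst (j : Fin 7) : c K j ∈ commConst (J K) := by
  rw [mem_commConst_iff]
  fin_cases j <;>
    simp [c, fox_c₁, fox_c₂, fox_c₃, fox_c₄, fox_c₅, fox_c₆, fox_c₇, Derivation.leibniz,
      Derivation.leibniz_pow, polyDelta_X₁, polyDelta_X₂, polyDelta_X₃, polyDelta_X₄,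
    polyDelta_ofNat, x₁, x₂, x₃, x₄] <;>
    and_intros <;> first | trivial | ring

/-! ### The relations -/

theorem f₃_smul_c₁ : f₃ K • c₁ K = -(f₂ K • c₃ K) + f₁ K ^ 2 • c₄ K := by
  apply fox_injective
  ext1 i
  fin_cases i <;> simp [fox_c₁, fox_c₃, fox_c₄, f₁, f₂, f₃] <;> ring

theorem f₃_smul_c₃ : f₃ K • c₃ K = -(f₂ K ^ 2 • c₁ K + f₁ K ^ 2 • c₅ K) := by
  apply fox_injective
  ext1 i
  fin_cases i <;> simp [fox_c₁, fox_c₃, fox_c₅, f₁, f₂, f₃] <;> ring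

variable [CharZero K]

theorem three_mul_C : 3 * C (8 / 3) = (8 : MvPolynomial (Fin 4) K) := by
  rw [← map_ofNat (C : K →+* MvPolynomial (Fin 4) K) 3, ← C_mul, mul_div_cancel₀ _ three_ne_zero,
    map_ofNat]

theorem f₄_mem : f₄ K ∈ polyConst (J K) := by
  change polyDelta (J K) (f₄ K) = 0
  have h : polyDelta (J K) (C (8 / 3)) = 0 := Derivation.map_algebraMap _ _
  simp only [f₄, map_add, map_sub, Derivation.leibniz, Derivation.leibniz_pow, polyDelta_X₁,
    polyDelta_X₂, polyDelta_X₃, polyDelta_X₄, h,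
    polyDelta_ofNat]
  simp
  linear_combination (-(X 0 * X 1 * X 2 ^ 2)) * three_mul_C K

/-- The multiple `3 f_4` has integer coefficients. -/
theorem three_mul_f₄ : 3 * f₄ K = 3 * X 1 ^ 2 * X 2 ^ 2 - 6 * X 1 ^ 3 * X 3
    + 18 * X 0 * X 1 * X 2 * X 3 - 8 * X 0 * X 2 ^ 3 - 9 * X 0 ^ 2 * X 3 ^ 2 := by
  rw [f₄]
  linear_combination (-(X 0 * X 2 ^ 3)) * three_mul_C K

theorem f₃_sq : f₃ K ^ 2 = f₂ K ^ 3 - 3 * f₁ K ^ 2 * f₄ K := by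
  have h : 3 * f₁ K ^ 2 * f₄ K = f₁ K ^ 2 * (3 * f₄ K) := by ring
  rw [h, three_mul_f₄, f₁, f₂, f₃]
  ring

theorem f₃_smul_c₄ : f₃ K • c₄ K = -((3 * f₄ K) • c₁ K + f₂ K • c₅ K) := by
  rw [three_mul_f₄]
  apply fox_injective
  ext1 i
  fin_cases i <;> simp [fox_c₁, fox_c₄, fox_c₅, f₂, f₃] <;> ring

theorem f₃_smul_c₅ : f₃ K • c₅ K = (3 * f₄ K) • c₃ K - f₂ K ^ 2 • c₄ K := by
  rw [three_mul_f₄]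
  apply fox_injective
  ext1 i
  fin_cases i <;> simp [fox_c₃, fox_c₄, fox_c₅, f₂, f₃] <;> ring

theorem f₁_smul_c₆ :
    f₁ K • c₆ K = (3 : K) • (f₄ K • c₁ K - f₂ K ^ 2 • c₂ K + f₂ K • c₅ K) := by
  have h : f₁ K • c₆ K = (3 * f₄ K) • c₁ K - (3 * f₂ K ^ 2) • c₂ K + (3 * f₂ K) • c₅ K := by
    rw [three_mul_f₄]
    apply fox_injective
    ext1 i
    fin_cases i <;> simp [fox_c₁, fox_c₂, fox_c₅, fox_c₆, f₁, f₂] <;> ring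
  rw [h, ← C_smul, map_ofNat]
  module

theorem f₁_smul_c₇ : f₁ K • c₇ K
    = (3 : K) • (-((f₂ K * f₃ K) • c₂ K) + (2 * f₄ K) • c₃ K - f₂ K ^ 2 • c₄ K) := by
  have h : f₁ K • c₇ K
      = -((3 * f₂ K * f₃ K) • c₂ K) + (2 * (3 * f₄ K)) • c₃ K - (3 * f₂ K ^ 2) • c₄ K := by
    rw [three_mul_f₄]
    apply fox_injective
    ext1 i
    fin_cases i <;> simp [fox_c₂, fox_c₃, fox_c₄, fox_c₇, f₁, f₂, f₃] <;> ring
  rw [h, ← C_smul, map_ofNat]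
  module

theorem f₃_smul_c₆ : f₃ K • c₆ K = (3 * f₁ K * f₄ K) • c₄ K + f₂ K • c₇ K := by
  have h : 3 * f₁ K * f₄ K = f₁ K * (3 * f₄ K) := by ring
  rw [h, three_mul_f₄]
  apply fox_injective
  ext1 i
  fin_cases i <;> simp [fox_c₄, fox_c₆, fox_c₇, f₁, f₂, f₃] <;> ring

theorem f₃_smul_c₇ : f₃ K • c₇ K
    = (9 * f₁ K * f₂ K * f₄ K) • c₂ K - (6 * f₁ K * f₄ K) • c₅ K + f₂ K ^ 2 • c₆ K := by
  have h : 9 * f₁ K * f₂ K * f₄ K = 3 * f₁ K * f₂ K * (3 * f₄ K) := by ring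
  have h' : 6 * f₁ K * f₄ K = 2 * f₁ K * (3 * f₄ K) := by ring
  rw [h, h', three_mul_f₄]
  apply fox_injective
  ext1 i
  fin_cases i <;> simp [fox_c₂, fox_c₅, fox_c₆, fox_c₇, f₁, f₂, f₃] <;> ring

end

section

variable (K : Type*) [Field K]

/-! ### Parity, and the substitution `x_1 = x_3 = 0` -/

/-- The automorphism of `K[X_4]` with `x_2 ↦ -x_2`, `x_4 ↦ -x_4`; it fixes `f_1`, `f_2` and `f_4`
and changes the sign of `f_3`. -/
def parity : MvPolynomial (Fin 4) K →ₐ[K] MvPolynomial (Fin 4) K :=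
  aeval ![X 0, -X 1, X 2, -X 3]

/-- The substitution `x_1 = x_3 = 0`. -/
def killOneThree : MvPolynomial (Fin 4) K →ₐ[K] MvPolynomial (Fin 4) K :=
  aeval ![0, X 1, 0, X 3]

/-- The homomorphism `K[y, z] → K[X_4]` with `y ↦ f_2`, `z ↦ f_4`. -/
def evalTwo : MvPolynomial (Fin 2) K →ₐ[K] MvPolynomial (Fin 4) K :=
  aeval ![f₂ K, f₄ K]

/-- The homomorphism `K[t, y, z] → K[X_4]` with `t ↦ f_1`, `y ↦ f_2`, `z ↦ f_4`. -/
def evalThree : MvPolynomial (Fin 3) K →ₐ[K] MvPolynomial (Fin 4) K :=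
  aeval ![f₁ K, f₂ K, f₄ K]

theorem parity_X (i : Fin 4) : parity K (X i) = ![X 0, -X 1, X 2, -X 3] i := aeval_X _ _

theorem killOneThree_X (i : Fin 4) : killOneThree K (X i) = ![0, X 1, 0, X 3] i := aeval_X _ _

theorem evalTwo_X (i : Fin 2) : evalTwo K (X i) = ![f₂ K, f₄ K] i := aeval_X _ _

theorem evalThree_X (i : Fin 3) : evalThree K (X i) = ![f₁ K, f₂ K, f₄ K] i := aeval_X _ _

theorem parity_f₁ : parity K (f₁ K) = f₁ K := by simp [parity_X, f₁, x₁]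

theorem parity_f₂ : parity K (f₂ K) = f₂ K := by
  simp only [f₂, map_sub, map_mul, map_pow, map_ofNat, parity_X]
  simp [x₁, x₂, x₃]

theorem parity_f₃ : parity K (f₃ K) = -f₃ K := by
  simp only [f₃, map_add, map_sub, map_mul, map_pow, map_ofNat, parity_X]
  simp [x₁, x₂, x₃, x₄]
  ring

theorem parity_f₄ : parity K (f₄ K) = f₄ K := by
  simp only [f₄, map_add, map_sub, map_mul, map_pow, map_ofNat, parity_X, algHom_C, algebraMap_eq]
  simp [x₁, x₂, x₃, x₄]
  ring

theorem killOneThree_f₁ : killOneThree K (f₁ K) = 0 := by simp [killOneThree_X, f₁, x₁]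

theorem killOneThree_f₂ : killOneThree K (f₂ K) = X 1 ^ 2 := by
  simp [killOneThree_X, f₂, x₁, x₂, x₃]

theorem killOneThree_f₃ : killOneThree K (f₃ K) = X 1 ^ 3 := by
  simp [killOneThree_X, f₃, x₁, x₂, x₃, x₄]

theorem killOneThree_f₄ : killOneThree K (f₄ K) = -(2 * X 1 ^ 3 * X 3) := by
  simp only [f₄, map_add, map_sub, map_mul, map_pow, map_ofNat, killOneThree_X]
  simp [x₁, x₂, x₃, x₄]

variable {K}

theorem parity_evalTwo (p : MvPolynomial (Fin 2) K) : parity K (evalTwo K p) = evalTwo K p := by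
  have h : (parity K).comp (evalTwo K) = evalTwo K := algHom_ext fun i => by
    fin_cases i <;> simp [evalTwo_X, parity_f₂, parity_f₄]
  exact AlgHom.congr_fun h p

theorem parity_evalThree (p : MvPolynomial (Fin 3) K) :
    parity K (evalThree K p) = evalThree K p := by
  have h : (parity K).comp (evalThree K) = evalThree K := algHom_ext fun i => by
    fin_cases i <;> simp [evalThree_X, parity_f₁, parity_f₂, parity_f₄]
  exact AlgHom.congr_fun h p

theorem parity_killOneThree (p : MvPolynomial (Fin 4) K) :
    parity K (killOneThree K p) = killOneThree K (parity K p) := by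
  have h : (parity K).comp (killOneThree K) = (killOneThree K).comp (parity K) :=
    algHom_ext fun i => by fin_cases i <;> simp [killOneThree_X, parity_X]
  exact AlgHom.congr_fun h p

/-- Elements of opposite parity are linearly independent. -/
theorem eq_zero_of_add_eq_zero [CharZero K] {p q : MvPolynomial (Fin 4) K} (hp : parity K p = p)
    (hq : parity K q = -q) (h : p + q = 0) : p = 0 ∧ q = 0 := by
  have h' := congrArg (parity K) h
  rw [map_add, hp, hq, map_zero] at h'
  have h₂ : 2 * p = 0 := by linear_combination h + h'
  have hp0 : p = 0 := by simpa using h₂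
  exact ⟨hp0, by simpa [hp0] using h⟩

/-- The images of `f_2` and `f_4` under `x_1 = x_3 = 0` are algebraically independent. -/
theorem killOneThree_evalTwo_eq_zero [CharZero K] {p : MvPolynomial (Fin 2) K}
    (hp : killOneThree K (evalTwo K p) = 0) : p = 0 := by
  have solve (F : Type _) [Field F] (y z : F) (hy : y ≠ 0) (h2 : (2 : F) ≠ 0) :
      -(2 * y ^ 3 * (-(z ^ 2) / (2 * y ^ 3))) = z ^ 2 := by field_simp
  let F := FractionRing (MvPolynomial (Fin 2) K)
  let y : F := algebraMap (MvPolynomial (Fin 2) K) F (X 0)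
  let z : F := algebraMap (MvPolynomial (Fin 2) K) F (X 1)
  have hy : y ≠ 0 := by simp [y]
  have h2 : (2 : F) ≠ 0 := two_ne_zero
  -- `x_2 ↦ y` and `x_4 ↦ -z² / (2 y³)` send the images of `f_2` and `f_4` to `y²` and `z²`.
  obtain ⟨h, hX⟩ : ∃ h : MvPolynomial (Fin 4) K →ₐ[K] F,
      ∀ i, h (X i) = ![0, y, 0, -(z ^ 2) / (2 * y ^ 3)] i := ⟨aeval _, aeval_X _⟩
  have key : (h.comp (killOneThree K)).comp (evalTwo K)
      = (IsScalarTower.toAlgHom K (MvPolynomial (Fin 2) K) F).comp (expand 2) := by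
    refine algHom_ext fun i => ?_
    rw [AlgHom.comp_apply, AlgHom.comp_apply, AlgHom.comp_apply, IsScalarTower.toAlgHom_apply,
      expand_X, map_pow, evalTwo_X]
    fin_cases i
    · change h (killOneThree K (f₂ K)) = y ^ 2
      rw [killOneThree_f₂, map_pow, hX]
      rfl
    · change h (killOneThree K (f₄ K)) = z ^ 2
      rw [killOneThree_f₄, map_neg, map_mul, map_mul, map_pow, map_ofNat, hX, hX]
      exact solve F y z hy h2
  have := AlgHom.congr_fun key p
  rw [AlgHom.comp_apply, AlgHom.comp_apply, hp, map_zero, AlgHom.comp_apply,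
    IsScalarTower.toAlgHom_apply, eq_comm,
    map_eq_zero_iff _ (IsFractionRing.injective (MvPolynomial (Fin 2) K) F)] at this
  exact (map_eq_zero_iff _ (expand_injective two_pos)).1 this

/-- The polynomials `f_1`, `f_2` and `f_4` are algebraically independent. -/
theorem evalThree_injective [CharZero K] : Function.Injective (evalThree K) := by
  let e : Polynomial (MvPolynomial (Fin 2) K) →+* MvPolynomial (Fin 4) K :=
    Polynomial.eval₂RingHom (evalTwo K : MvPolynomial (Fin 2) K →+* _) (f₁ K)
  -- A relation has zero constant term with respect to `f_1`, as `x_1 = x_3 = 0` shows, and can be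
  -- divided by `f_1`.
  have he (n : ℕ) : ∀ q, e q = 0 → q.coeff n = 0 := by
    have h0 (q) (hq : e q = 0) : q.coeff 0 = 0 ∧ e q.divX = 0 := by
      have hq' : e q.divX * f₁ K + evalTwo K (q.coeff 0) = 0 := by
        rw [← hq]
        conv_rhs => rw [← Polynomial.divX_mul_X_add q]
        simp [e]
      have h1 : q.coeff 0 = 0 := by
        apply killOneThree_evalTwo_eq_zero
        simpa [killOneThree_f₁] using congrArg (killOneThree K) hq'
      rw [h1, map_zero, add_zero] at hq'
      exact ⟨h1, (mul_eq_zero.1 hq').resolve_right (X_ne_zero _)⟩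
    induction n with
    | zero => exact fun q hq => (h0 q hq).1
    | succ n ih =>
      intro q hq
      rw [← Polynomial.coeff_divX]
      exact ih _ (h0 q hq).2
  have key : (evalThree K : MvPolynomial (Fin 3) K →+* _)
      = e.comp (finSuccEquiv K 2 : MvPolynomial (Fin 3) K →+* _) := by
    refine ringHom_ext (fun a => ?_) fun i => ?_
    · simp [e, finSuccEquiv_apply]
    · refine Fin.cases ?_ (fun i => ?_) i
      · simp [e, evalThree_X, finSuccEquiv_X_zero]
      · simp only [RingHom.coe_coe, RingHom.comp_apply, evalThree_X, finSuccEquiv_X_succ, e,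
          Polynomial.coe_eval₂RingHom, Polynomial.eval₂_C, evalTwo_X]
        fin_cases i <;> rfl
  refine (injective_iff_map_eq_zero _).2 fun p hp => ?_
  have hp' : e (finSuccEquiv K 2 p) = 0 := by
    rw [← hp]; exact (RingHom.congr_fun key p).symm
  have : finSuccEquiv K 2 p = 0 := Polynomial.ext fun n => he n _ hp'
  simpa using this

/-! ### Constants of the polynomial algebra after localization -/

variable (K) in
/-- The homomorphism `K[X_4] → K[X_4]` with `x_1 ↦ x_1`, `x_2 ↦ x_2`, `x_3 ↦ f_2`, `x_4 ↦ f_3`. It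
becomes an isomorphism after inverting `x_1`. -/
def slice : MvPolynomial (Fin 4) K →ₐ[K] MvPolynomial (Fin 4) K :=
  aeval ![X 0, X 1, f₂ K, f₃ K]

theorem slice_X (K : Type*) [Field K] (i : Fin 4) : slice K (X i) = ![X 0, X 1, f₂ K, f₃ K] i :=
  aeval_X _ _

theorem slice_injective [CharZero K] : Function.Injective (slice K) := by
  have solve₂ (F : Type _) [Field F] (y : Fin 4 → F) (hy : y 0 ≠ 0) (h2 : (2 : F) ≠ 0) :
      y 1 ^ 2 - 2 * y 0 * ((y 1 ^ 2 - y 2) / (2 * y 0)) = y 2 := by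
    field_simp
    ring
  have solve₃ (F : Type _) [Field F] (y : Fin 4 → F) (hy : y 0 ≠ 0) (h2 : (2 : F) ≠ 0)
      (h6 : (6 : F) ≠ 0) : y 1 ^ 3 - 3 * y 0 * y 1 * ((y 1 ^ 2 - y 2) / (2 * y 0))
        + 3 * y 0 ^ 2 * ((2 * y 3 + y 1 ^ 3 - 3 * y 1 * y 2) / (6 * y 0 ^ 2)) = y 3 := by
    field_simp
    ring
  let F := FractionRing (MvPolynomial (Fin 4) K)
  let y (i : Fin 4) : F := algebraMap (MvPolynomial (Fin 4) K) F (X i)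
  have hy : y 0 ≠ 0 := by simp [y]
  have h2 : (2 : F) ≠ 0 := two_ne_zero
  -- The inverse is obtained by solving the formulas for `f_2` and `f_3` for `x_3` and `x_4`.
  obtain ⟨h, hX⟩ : ∃ h : MvPolynomial (Fin 4) K →ₐ[K] F,
      ∀ i, h (X i) = ![y 0, y 1, (y 1 ^ 2 - y 2) / (2 * y 0),
        (2 * y 3 + y 1 ^ 3 - 3 * y 1 * y 2) / (6 * y 0 ^ 2)] i := ⟨aeval _, aeval_X _⟩
  have key : h.comp (slice K) = IsScalarTower.toAlgHom K (MvPolynomial (Fin 4) K) F := by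
    refine algHom_ext fun i => ?_
    rw [AlgHom.comp_apply, slice_X, IsScalarTower.toAlgHom_apply]
    fin_cases i
    · exact hX 0
    · exact hX 1
    · change h (f₂ K) = y 2
      simp only [f₂, map_sub, map_mul, map_pow, map_ofNat, hX]
      exact solve₂ F y hy h2
    · change h (f₃ K) = y 3
      have h6 : (6 : F) ≠ 0 := by norm_num
      simp only [f₃, map_add, map_sub, map_mul, map_pow, map_ofNat, hX]
      exact solve₃ F y hy h2 h6
  refine (injective_iff_map_eq_zero _).2 fun p hp => ?_
  have := AlgHom.congr_fun key p
  rwa [AlgHom.comp_apply, hp, map_zero, IsScalarTower.toAlgHom_apply, eq_comm,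
    map_eq_zero_iff _ (IsFractionRing.injective (MvPolynomial (Fin 4) K) F)] at this

theorem exists_pow_mul_eq_slice [CharZero K] (p : MvPolynomial (Fin 4) K) :
    ∃ (k : ℕ) (q : MvPolynomial (Fin 4) K), X 0 ^ k * p = slice K q := by
  have hX (i : Fin 4) : ∃ (k : ℕ) (q : MvPolynomial (Fin 4) K), X 0 ^ k * X i = slice K q := by
    have h2 : C (1 / 2) * 2 = (1 : MvPolynomial (Fin 4) K) := by
      rw [← map_ofNat (C : K →+* MvPolynomial (Fin 4) K) 2, ← C_mul]; simp
    have h6 : C (1 / 6) * 6 = (1 : MvPolynomial (Fin 4) K) := by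
      rw [← map_ofNat (C : K →+* MvPolynomial (Fin 4) K) 6, ← C_mul]; simp
    fin_cases i
    · exact ⟨0, X 0, by simp [slice_X]⟩
    · exact ⟨0, X 1, by simp [slice_X]⟩
    · refine ⟨1, C (1 / 2) * (X 1 ^ 2 - X 2), ?_⟩
      simp only [map_mul, map_sub, map_pow, algHom_C, algebraMap_eq, slice_X]
      change X 0 ^ 1 * X 2 = C (1 / 2) * (X 1 ^ 2 - f₂ K)
      rw [f₂]
      linear_combination (-(X 0 * X 2)) * h2
    · refine ⟨2, C (1 / 6) * (2 * X 3 + X 1 ^ 3 - 3 * X 1 * X 2), ?_⟩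
      simp only [map_sub, map_add, map_mul, map_ofNat, map_pow, algHom_C, algebraMap_eq, slice_X]
      change X 0 ^ 2 * X 3 = C (1 / 6) * (2 * f₃ K + X 1 ^ 3 - 3 * X 1 * f₂ K)
      rw [f₂, f₃]
      linear_combination (-(X 0 ^ 2 * X 3)) * h6
  induction p using MvPolynomial.induction_on with
  | C a => exact ⟨0, C a, by simp [algHom_C]⟩
  | add p q hp hq =>
    obtain ⟨k, a, ha⟩ := hp
    obtain ⟨l, b, hb⟩ := hq
    have h0 : slice K (X 0) = X 0 := by simp [slice_X]
    refine ⟨k + l, X 0 ^ l * a + X 0 ^ k * b, ?_⟩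
    rw [map_add, map_mul, map_mul, map_pow, map_pow, h0, ← ha, ← hb]
    ring
  | mul_X p i hp =>
    obtain ⟨k, a, ha⟩ := hp
    obtain ⟨l, b, hb⟩ := hX i
    exact ⟨k + l, a * b, by rw [map_mul, ← ha, ← hb]; ring⟩

theorem polyDelta_slice (q : MvPolynomial (Fin 4) K) :
    polyDelta (J K) (slice K q) = X 0 * slice K (pderiv 1 q) := by
  have h₂ : polyDelta (J K) (f₂ K) = 0 := f₂_mem K
  have h₃ : polyDelta (J K) (f₃ K) = 0 := f₃_mem K
  induction q using MvPolynomial.induction_on with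
  | C a => simp [algHom_C, polyDelta]
  | add p q hp hq => simp only [map_add, hp, hq, mul_add]
  | mul_X p i hp =>
    have hX : polyDelta (J K) (slice K (X i)) = X 0 * slice K (pderiv 1 (X i)) := by
      fin_cases i <;>
        simp [slice_X, pderiv_X, polyDelta_X₁, polyDelta_X₂, h₂, h₃]
    simp only [map_mul, Derivation.leibniz, hp, hX, smul_eq_mul, map_add]
    ring

variable (K) in
/-- The subalgebra generated by `f_1, …, f_4`. -/
def fAlg : Subalgebra K (MvPolynomial (Fin 4) K) :=
  Algebra.adjoin K {f₁ K, f₂ K, f₃ K, f₄ K}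

/-- A constant is a polynomial in `f_1`, `f_2` and `f_3` up to a power of `x_1`: on the image of
`slice` the derivation is `x_1 ∂/∂x_2`. -/
theorem exists_pow_mul_mem_fAlg [CharZero K] {p : MvPolynomial (Fin 4) K}
    (hp : polyDelta (J K) p = 0) :
    ∃ k, ∀ n, k ≤ n → X 0 ^ n * p ∈ fAlg K := by
  obtain ⟨k, q, hq⟩ := exists_pow_mul_eq_slice p
  have hq0 : pderiv 1 q = 0 := by
    have h := polyDelta_slice q
    rw [← hq, Derivation.leibniz, Derivation.leibniz_pow, hp, polyDelta_X₁, smul_zero, smul_zero,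
      smul_zero, smul_zero, add_zero, eq_comm, mul_eq_zero] at h
    exact (map_eq_zero_iff _ slice_injective).1 (h.resolve_left (X_ne_zero _))
  have hq1 : q ∈ supported K ({1}ᶜ : Set (Fin 4)) := by
    rw [mem_supported]
    rintro i hi rfl
    obtain ⟨m, hm, hmi⟩ := (mem_vars_iff_mem_support _).1 hi
    have h := congrArg (coeff (m - Finsupp.single 1 1)) hq0
    have hle : Finsupp.single (1 : Fin 4) 1 ≤ m := by
      rw [Finsupp.single_le_iff]
      exact Nat.one_le_iff_ne_zero.2 (Finsupp.mem_support_iff.1 hmi)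
    rw [coeff_pderiv, tsub_add_cancel_of_le hle, coeff_zero, mul_eq_zero] at h
    rcases h with h | h
    · exact mem_support_iff.1 hm h
    · exact Nat.cast_add_one_ne_zero _ h
  have hf₁ : f₁ K ∈ fAlg K := Algebra.subset_adjoin (by simp)
  have hf₂ : f₂ K ∈ fAlg K := Algebra.subset_adjoin (by simp)
  have hf₃ : f₃ K ∈ fAlg K := Algebra.subset_adjoin (by simp)
  have hs : slice K q ∈ fAlg K := by
    rw [supported_eq_adjoin_X] at hq1
    have h : (Algebra.adjoin K (X '' ({1}ᶜ : Set (Fin 4)))).map (slice K) ≤ fAlg K := by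
      rw [AlgHom.map_adjoin]
      refine Algebra.adjoin_le ?_
      rintro _ ⟨_, ⟨i, hi, rfl⟩, rfl⟩
      fin_cases i
      · exact (slice_X K 0).symm ▸ hf₁
      · exact absurd rfl hi
      · simpa [slice_X] using hf₂
      · simpa [slice_X] using hf₃
    exact h ⟨q, hq1, rfl⟩
  refine ⟨k, fun n hn => ?_⟩
  obtain ⟨l, rfl⟩ := Nat.exists_eq_add_of_le' hn
  rw [pow_add, mul_assoc, hq]
  exact mul_mem (pow_mem hf₁ l) hs

end

section

variable {K : Type*} [Field K]

/-! ### The span of the basis -/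

variable (K) in
/-- The vector space spanned by the elements that are to form a basis of the constants. -/
def basisSpan : Submodule K (CommutatorIdeal K (Fin 4)) := Submodule.span K (Set.range (basisC K))

theorem basisC_mem (i) : basisC K i ∈ basisSpan K := Submodule.subset_span ⟨i, rfl⟩

theorem mem_commConst_of_mem_basisSpan [CharZero K] {w : CommutatorIdeal K (Fin 4)}
    (hw : w ∈ basisSpan K) :
    w ∈ commConst (J K) := by
  have h₁ := f₁_mem K
  have h₂ := f₂_mem K
  have h₃ := f₃_mem K
  have h₄ := f₄_mem K
  have hc (j : Fin 7) {p} (hp : p ∈ polyConst (J K)) : p • c K j ∈ commConst (J K) :=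
    (commConst (J K)).smul_mem ⟨p, hp⟩ (c_mem_commConst K j)
  induction hw using Submodule.span_induction with
  | mem x hx =>
    obtain ⟨⟨j, q, r, s⟩ | ⟨j, r, s⟩ | ⟨q, r, e, s⟩, rfl⟩ := hx
    · have h := mul_mem (mul_mem (pow_mem h₁ q) (pow_mem h₂ r)) (pow_mem h₄ s)
      fin_cases j
      exacts [hc 0 h, hc 2 h, hc 3 h, hc 4 h]
    · have h := mul_mem (pow_mem h₂ r) (pow_mem h₄ s)
      fin_cases j
      exacts [hc 5 h, hc 6 h]
    · exact hc 1 (mul_mem (mul_mem (mul_mem (pow_mem h₁ q) (pow_mem h₂ r)) (pow_mem h₃ e))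
        (pow_mem h₄ s))
  | zero => exact zero_mem _
  | add x y _ _ hx hy => exact add_mem hx hy
  | smul a x _ hx =>
    have := (commConst (J K)).smul_mem (algebraMap K (polyConst (J K)) a) hx
    rwa [← C_smul]

theorem pow_smul_c_mem [CharZero K] (j : Fin 7) (q r s : ℕ) :
    (f₁ K ^ q * f₂ K ^ r * f₄ K ^ s) • c K j ∈ basisSpan K := by
  have h₁ (q r s) : (f₁ K ^ q * f₂ K ^ r * f₄ K ^ s) • c₁ K ∈ basisSpan K :=
    basisC_mem (.inl (0, q, r, s))
  have h₂ (q r s) : (f₁ K ^ q * f₂ K ^ r * f₄ K ^ s) • c₂ K ∈ basisSpan K := by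
    simpa [basisC] using basisC_mem (K := K) (.inr (.inr (q, r, 0, s)))
  have h₂' (q r s) : (f₁ K ^ q * f₂ K ^ r * f₃ K * f₄ K ^ s) • c₂ K ∈ basisSpan K := by
    simpa [basisC] using basisC_mem (K := K) (.inr (.inr (q, r, 1, s)))
  have h₃ (q r s) : (f₁ K ^ q * f₂ K ^ r * f₄ K ^ s) • c₃ K ∈ basisSpan K :=
    basisC_mem (.inl (1, q, r, s))
  have h₄ (q r s) : (f₁ K ^ q * f₂ K ^ r * f₄ K ^ s) • c₄ K ∈ basisSpan K :=
    basisC_mem (.inl (2, q, r, s))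
  have h₅ (q r s) : (f₁ K ^ q * f₂ K ^ r * f₄ K ^ s) • c₅ K ∈ basisSpan K :=
    basisC_mem (.inl (3, q, r, s))
  fin_cases j
  · exact h₁ q r s
  · exact h₂ q r s
  · exact h₃ q r s
  · exact h₄ q r s
  · exact h₅ q r s
  · rcases q with - | q
    · simpa [basisC, c] using basisC_mem (K := K) (.inr (.inl (0, r, s)))
    · have e : (f₁ K ^ (q + 1) * f₂ K ^ r * f₄ K ^ s) • c₆ K
          = (3 : K) • ((f₁ K ^ q * f₂ K ^ r * f₄ K ^ (s + 1)) • c₁ K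
            - (f₁ K ^ q * f₂ K ^ (r + 2) * f₄ K ^ s) • c₂ K
            + (f₁ K ^ q * f₂ K ^ (r + 1) * f₄ K ^ s) • c₅ K) := by
        have h := congrArg ((f₁ K ^ q * f₂ K ^ r * f₄ K ^ s) • ·) (f₁_smul_c₆ K)
        simp only [← C_smul] at h ⊢
        linear_combination (norm := module) h
      change _ • c₆ K ∈ _
      rw [e]
      exact Submodule.smul_mem _ _ (add_mem (sub_mem (h₁ _ _ _) (h₂ _ _ _)) (h₅ _ _ _))
  · rcases q with - | q
    · simpa [basisC, c] using basisC_mem (K := K) (.inr (.inl (1, r, s)))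
    · have e : (f₁ K ^ (q + 1) * f₂ K ^ r * f₄ K ^ s) • c₇ K
          = (3 : K) • (-((f₁ K ^ q * f₂ K ^ (r + 1) * f₃ K * f₄ K ^ s) • c₂ K)
            + (2 : K) • (f₁ K ^ q * f₂ K ^ r * f₄ K ^ (s + 1)) • c₃ K
            - (f₁ K ^ q * f₂ K ^ (r + 2) * f₄ K ^ s) • c₄ K) := by
        have h := congrArg ((f₁ K ^ q * f₂ K ^ r * f₄ K ^ s) • ·) (f₁_smul_c₇ K)
        simp only [← C_smul, map_ofNat C] at h ⊢
        linear_combination (norm := module) h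
      change _ • c₇ K ∈ _
      rw [e]
      exact Submodule.smul_mem _ _ (sub_mem (add_mem (neg_mem (h₂' _ _ _))
        (Submodule.smul_mem _ _ (h₃ _ _ _))) (h₄ _ _ _))

theorem evalThree_smul_mem {u : CommutatorIdeal K (Fin 4)}
    (h : ∀ q r s, (f₁ K ^ q * f₂ K ^ r * f₄ K ^ s) • u ∈ basisSpan K)
    {b : MvPolynomial (Fin 4) K} (hb : b ∈ (evalThree K).range) : b • u ∈ basisSpan K := by
  obtain ⟨p, rfl⟩ := hb
  change evalThree K p • u ∈ _
  induction p using MvPolynomial.induction_on' with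
  | monomial m a =>
    have e : evalThree K (monomial m a) = C a * (f₁ K ^ m 0 * f₂ K ^ m 1 * f₄ K ^ m 2) := by
      rw [evalThree, aeval_monomial, Finsupp.prod_fintype _ _ (fun _ => pow_zero _),
        Fin.prod_univ_three]
      rfl
    rw [e, mul_smul, C_smul]
    exact Submodule.smul_mem _ _ (h _ _ _)
  | add p q hp hq =>
    rw [map_add, add_smul]
    exact add_mem hp hq

theorem smul_c_mem [CharZero K] {b : MvPolynomial (Fin 4) K}
    (hb : b ∈ (evalThree K).range) (j : Fin 7) :
    b • c K j ∈ basisSpan K :=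
  evalThree_smul_mem (pow_smul_c_mem j) hb

theorem smul_f₃_smul_c₂_mem {b : MvPolynomial (Fin 4) K} (hb : b ∈ (evalThree K).range) :
    b • f₃ K • c₂ K ∈ basisSpan K := by
  refine evalThree_smul_mem (fun q r s => ?_) hb
  have := basisC_mem (K := K) (.inr (.inr (q, r, 1, s)))
  simp only [basisC, Fin.val_one, pow_one] at this
  rwa [smul_smul, mul_right_comm]

theorem evalTwo_mem_range (p : MvPolynomial (Fin 2) K) : evalTwo K p ∈ (evalThree K).range := by
  have h : evalTwo K = (evalThree K).comp (rename Fin.succ) := algHom_ext fun i => by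
    fin_cases i <;> simp [evalTwo_X, evalThree_X]
  rw [h]
  exact ⟨_, rfl⟩

variable (K) in
theorem f₁_mem_range : f₁ K ∈ (evalThree K).range := ⟨X 0, evalThree_X K 0⟩
variable (K) in
theorem f₂_mem_range : f₂ K ∈ (evalThree K).range := ⟨X 1, evalThree_X K 1⟩
variable (K) in
theorem f₄_mem_range : f₄ K ∈ (evalThree K).range := ⟨X 2, evalThree_X K 2⟩

/-- The span is closed under multiplication by an element that maps the products of the `c_j` and
of `c_2 f_3` with polynomials in `f_1`, `f_2`, `f_4` into the span. -/
theorem smul_mem_of_generators {g : MvPolynomial (Fin 4) K}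
    (h : ∀ b ∈ (evalThree K).range, ∀ j, b • g • c K j ∈ basisSpan K)
    (h' : ∀ b ∈ (evalThree K).range, b • g • f₃ K • c₂ K ∈ basisSpan K)
    {w : CommutatorIdeal K (Fin 4)} (hw : w ∈ basisSpan K) : g • w ∈ basisSpan K := by
  have h₁ := f₁_mem_range K
  have h₂ := f₂_mem_range K
  have h₄ := f₄_mem_range K
  induction hw using Submodule.span_induction with
  | mem x hx =>
    obtain ⟨⟨j, q, r, s⟩ | ⟨j, r, s⟩ | ⟨q, r, e, s⟩, rfl⟩ := hx
    · have hb := mul_mem (mul_mem (pow_mem h₁ q) (pow_mem h₂ r)) (pow_mem h₄ s)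
      simp only [basisC]
      rw [smul_comm]
      fin_cases j
      exacts [h _ hb 0, h _ hb 2, h _ hb 3, h _ hb 4]
    · have hb := mul_mem (pow_mem h₂ r) (pow_mem h₄ s)
      simp only [basisC]
      rw [smul_comm]
      fin_cases j
      exacts [h _ hb 5, h _ hb 6]
    · have hb := mul_mem (mul_mem (pow_mem h₁ q) (pow_mem h₂ r)) (pow_mem h₄ s)
      simp only [basisC]
      rw [smul_comm, mul_right_comm, mul_smul, smul_comm (f₃ K ^ _) g]
      fin_cases e
      · simpa [c] using h _ hb 1
      · simpa using h' _ hb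
  | zero => rw [smul_zero]; exact zero_mem _
  | add x y _ _ hx hy => rw [smul_add]; exact add_mem hx hy
  | smul a x _ hx => rw [smul_comm]; exact Submodule.smul_mem _ _ hx

theorem range_smul_mem [CharZero K] {g : MvPolynomial (Fin 4) K} (hg : g ∈ (evalThree K).range)
    {w : CommutatorIdeal K (Fin 4)} (hw : w ∈ basisSpan K) : g • w ∈ basisSpan K := by
  refine smul_mem_of_generators (fun b hb j => ?_) (fun b hb => ?_) hw
  · rw [smul_smul]
    exact smul_c_mem (mul_mem hb hg) j
  · rw [smul_smul]
    exact smul_f₃_smul_c₂_mem (mul_mem hb hg)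

theorem f₃_smul_mem [CharZero K] {w : CommutatorIdeal K (Fin 4)} (hw : w ∈ basisSpan K) :
    f₃ K • w ∈ basisSpan K := by
  have h₁ := f₁_mem_range K
  have h₂ := f₂_mem_range K
  have h₄ := f₄_mem_range K
  have hn (n : ℕ) [n.AtLeastTwo] : (ofNat(n) : MvPolynomial (Fin 4) K) ∈ (evalThree K).range :=
    ofNat_mem _ n
  have hc (j : Fin 7) {g} (hg : g ∈ (evalThree K).range) : g • c K j ∈ basisSpan K :=
    smul_c_mem hg j
  refine smul_mem_of_generators (fun b hb j => range_smul_mem hb ?_)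
    (fun b hb => range_smul_mem hb ?_) hw
  · fin_cases j
    · change f₃ K • c₁ K ∈ _
      rw [f₃_smul_c₁]
      exact add_mem (neg_mem (hc 2 h₂)) (hc 3 (pow_mem h₁ 2))
    · simpa [c] using smul_f₃_smul_c₂_mem (K := K) (one_mem _)
    · change f₃ K • c₃ K ∈ _
      rw [f₃_smul_c₃]
      exact neg_mem (add_mem (hc 0 (pow_mem h₂ 2)) (hc 4 (pow_mem h₁ 2)))
    · change f₃ K • c₄ K ∈ _
      rw [f₃_smul_c₄]
      exact neg_mem (add_mem (hc 0 (mul_mem (hn 3) h₄)) (hc 4 h₂))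
    · change f₃ K • c₅ K ∈ _
      rw [f₃_smul_c₅]
      exact sub_mem (hc 2 (mul_mem (hn 3) h₄)) (hc 3 (pow_mem h₂ 2))
    · change f₃ K • c₆ K ∈ _
      rw [f₃_smul_c₆]
      exact add_mem (hc 3 (mul_mem (mul_mem (hn 3) h₁) h₄)) (hc 6 h₂)
    · change f₃ K • c₇ K ∈ _
      rw [f₃_smul_c₇]
      exact add_mem (sub_mem (hc 1 (mul_mem (mul_mem (mul_mem (hn 9) h₁) h₂) h₄))
        (hc 4 (mul_mem (mul_mem (hn 6) h₁) h₄))) (hc 5 (pow_mem h₂ 2))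
  · rw [smul_smul, ← sq, f₃_sq]
    exact hc 1 (sub_mem (pow_mem h₂ 3) (mul_mem (mul_mem (hn 3) (pow_mem h₁ 2)) h₄))

theorem fAlg_smul_mem [CharZero K] {g : MvPolynomial (Fin 4) K} (hg : g ∈ fAlg K)
    {w : CommutatorIdeal K (Fin 4)} (hw : w ∈ basisSpan K) : g • w ∈ basisSpan K := by
  induction hg using Algebra.adjoin_induction generalizing w with
  | mem x hx =>
    rcases hx with rfl | rfl | rfl | rfl
    exacts [range_smul_mem (f₁_mem_range K) hw, range_smul_mem (f₂_mem_range K) hw,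
      f₃_smul_mem hw, range_smul_mem (f₄_mem_range K) hw]
  | algebraMap a => rw [algebraMap_eq, C_smul]; exact Submodule.smul_mem _ _ hw
  | add x y _ _ hx hy => rw [add_smul]; exact add_mem (hx hw) (hy hw)
  | mul x y _ _ hx hy => rw [mul_smul]; exact hx (hy hw)

end

section

variable {K : Type*} [Field K]

/-! ### The span is saturated with respect to `x_1` -/

variable (K) in
/-- The generators `c_1, …, c_7`, `c_2 f_3` of the span as a module over `K[f_1, f_2, f_4]`. -/
def gens : Fin 8 → CommutatorIdeal K (Fin 4) :=
  ![c₁ K, c₂ K, c₃ K, c₄ K, c₅ K, c₆ K, c₇ K, f₃ K • c₂ K]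

set_option maxHeartbeats 1000000 in
theorem exists_eq_sum_gens_add {w : CommutatorIdeal K (Fin 4)} (hw : w ∈ basisSpan K) :
    ∃ (p : Fin 8 → MvPolynomial (Fin 2) K), ∃ n ∈ basisSpan K,
      w = ∑ i, evalTwo K (p i) • gens K i + f₁ K • n := by
  have hmon (i : Fin 8) (r s : ℕ) : ∃ (p : Fin 8 → MvPolynomial (Fin 2) K), ∃ n ∈ basisSpan K,
      (f₂ K ^ r * f₄ K ^ s) • gens K i = ∑ i, evalTwo K (p i) • gens K i + f₁ K • n := by
    refine ⟨Pi.single i (X 0 ^ r * X 1 ^ s), 0, zero_mem _, ?_⟩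
    rw [Finset.sum_eq_single i (fun j _ hj => by rw [Pi.single_eq_of_ne hj, map_zero, zero_smul])
      (by simp), Pi.single_eq_same, map_mul, map_pow, map_pow, evalTwo_X, evalTwo_X]
    simp
  have hf₁ {x y : CommutatorIdeal K (Fin 4)} (hx : x ∈ basisSpan K) (h : y = f₁ K • x) :
      ∃ (p : Fin 8 → MvPolynomial (Fin 2) K), ∃ n ∈ basisSpan K,
        y = ∑ i, evalTwo K (p i) • gens K i + f₁ K • n := by
    exact ⟨0, x, hx, by simp [h]⟩
  induction hw using Submodule.span_induction with
  | mem x hx =>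
    obtain ⟨⟨j, q, r, s⟩ | ⟨j, r, s⟩ | ⟨q, r, e, s⟩, rfl⟩ := hx
    · rcases q with - | q
      · simp only [basisC, pow_zero, one_mul]
        fin_cases j
        exacts [hmon 0 r s, hmon 2 r s, hmon 3 r s, hmon 4 r s]
      · refine hf₁ (basisC_mem (.inl (j, q, r, s))) ?_
        simp only [basisC, smul_smul]
        congr 1
        ring
    · simp only [basisC]
      fin_cases j
      exacts [hmon 5 r s, hmon 6 r s]
    · rcases q with - | q
      · simp only [basisC, pow_zero, one_mul]
        fin_cases e
        · simpa [gens] using hmon 1 r s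
        · have h := hmon 7 r s
          rw [show gens K 7 = f₃ K • c₂ K from rfl, smul_smul] at h
          simpa [mul_right_comm] using h
      · refine hf₁ (basisC_mem (.inr (.inr (q, r, e, s)))) ?_
        simp only [basisC, smul_smul]
        congr 1
        ring
  | zero => exact hf₁ (zero_mem _) (smul_zero _).symm
  | add x y _ _ hx hy =>
    obtain ⟨p, n, hn, rfl⟩ := hx
    obtain ⟨q, m, hm, rfl⟩ := hy
    refine ⟨fun i => p i + q i, n + m, add_mem hn hm, ?_⟩
    rw [smul_add (f₁ K) n m, add_add_add_comm, ← Finset.sum_add_distrib]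
    congr 1
    exact Finset.sum_congr rfl fun i _ => by rw [map_add, add_smul]
  | smul a x _ hx =>
    obtain ⟨p, n, hn, rfl⟩ := hx
    refine ⟨fun i => a • p i, a • n, Submodule.smul_mem _ _ hn, ?_⟩
    rw [smul_add a _ (f₁ K • n), Finset.smul_sum, smul_comm a (f₁ K)]
    congr 1
    exact Finset.sum_congr rfl fun i _ => by rw [map_smul, smul_assoc]

theorem f₁_smul_injective {u v : CommutatorIdeal K (Fin 4)} (h : f₁ K • u = f₁ K • v) : u = v := by
  apply fox_injective
  funext k
  have := congrFun (congrArg (fox K (Fin 4)) h) k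
  rw [map_smul, map_smul, Pi.smul_apply, Pi.smul_apply, smul_eq_mul, smul_eq_mul] at this
  exact mul_left_cancel₀ (X_ne_zero _) this

/-- The relations between the generators modulo `x_1` over `K[f_2, f_4]`: they are spanned by the
two relations that express `c_6 f_1` and `c_7 f_1`. -/
theorem gens_relations [CharZero K] {p : Fin 8 → MvPolynomial (Fin 2) K}
    {u : CommutatorIdeal K (Fin 4)} (h : ∑ i, evalTwo K (p i) • gens K i = f₁ K • u) :
    ∃ a b, p = ![X 1 * a, -(X 0 ^ 2 * a), -(2 * X 1 * b), X 0 ^ 2 * b, X 0 * a, 0, 0, X 0 * b] := by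
  have hk (k : Fin 4) := congrArg (killOneThree K) (congrFun (congrArg (fox K (Fin 4)) h) k)
  simp only [map_sum, map_smul, Finset.sum_apply, Pi.smul_apply, smul_eq_mul, map_mul,
    killOneThree_f₁, zero_mul] at hk
  -- The images of `K[f_2, f_4]` are even.
  have hpar (q : MvPolynomial (Fin 2) K) : parity K (killOneThree K (evalTwo K q))
      = killOneThree K (evalTwo K q) := by
    rw [parity_killOneThree, parity_evalTwo]
  have hX : (X 1 : MvPolynomial (Fin 4) K) ≠ 0 := X_ne_zero 1
  have hX₂ : parity K (X 1) = -X 1 := parity_X K 1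
  have hX₄ : parity K (X 3) = -X 3 := parity_X K 3
  have k₂ : killOneThree K (evalTwo K (X 0)) = X 1 ^ 2 := by
    rw [evalTwo_X]; exact killOneThree_f₂ K
  have k₄ : killOneThree K (evalTwo K (X 1)) = -(2 * X 1 ^ 3 * X 3) := by
    rw [evalTwo_X]; exact killOneThree_f₄ K
  have hinj {q r : MvPolynomial (Fin 2) K}
      (hqr : killOneThree K (evalTwo K q) = killOneThree K (evalTwo K r)) : q = r := by
    rw [← sub_eq_zero]
    apply killOneThree_evalTwo_eq_zero
    rw [map_sub, map_sub, hqr, sub_self]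
  have e₃ := hk 3
  have e₂ := hk 2
  have e₀ := hk 0
  simp [Fin.sum_univ_eight, gens, fox_c₁, fox_c₂, fox_c₃, fox_c₄, fox_c₅, fox_c₆, fox_c₇,
    killOneThree_X, killOneThree_f₃, map_ofNat] at e₃ e₂ e₀
  have hq (i : Fin 8) : parity K (killOneThree K (evalTwo K (p i)))
      = killOneThree K (evalTwo K (p i)) := hpar (p i)
  set P : Fin 8 → MvPolynomial (Fin 4) K := fun i => killOneThree K (evalTwo K (p i)) with hP
  -- Each coordinate is the sum of an even and an odd polynomial.
  obtain ⟨a₃, b₃⟩ := eq_zero_of_add_eq_zero (p := -(P 5 * (3 * X 1 ^ 4)))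
    (q := -(P 6 * (3 * X 1 ^ 5)))
    (by simp only [hP, map_neg, map_mul, map_pow, map_ofNat, hq, hX₂]; ring)
    (by simp only [hP, map_neg, map_mul, map_pow, map_ofNat, hq, hX₂]; ring) e₃
  obtain ⟨a₂, b₂⟩ := eq_zero_of_add_eq_zero (p := P 3 * X 1 ^ 2 - P 7 * X 1 ^ 4)
    (q := -(P 1 * X 1) - P 4 * X 1 ^ 3)
    (by simp only [hP, map_sub, map_mul, map_pow, hq, hX₂]; ring)
    (by simp only [hP, map_sub, map_neg, map_mul, map_pow, hq, hX₂]; ring)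
    (by linear_combination e₂)
  obtain ⟨a₀, b₀⟩ := eq_zero_of_add_eq_zero
    (p := P 2 * X 1 ^ 2 - 3 * P 3 * X 1 * X 3 - P 7 * X 1 ^ 3 * X 3)
    (q := -(P 0 * X 1) - P 1 * X 3 - 3 * P 4 * X 1 ^ 2 * X 3)
    (by simp only [hP, map_sub, map_mul, map_pow, map_ofNat, hq, hX₂, hX₄]; ring)
    (by simp only [hP, map_sub, map_neg, map_mul, map_pow, map_ofNat, hq, hX₂, hX₄]; ring)
    (by linear_combination e₀)
  have p₅ : p 5 = 0 := hinj (by simpa [hX] using a₃)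
  have p₆ : p 6 = 0 := hinj (by simpa [hX] using b₃)
  have p₃ : p 3 = X 0 * p 7 := hinj <| by
    rw [map_mul, map_mul, k₂]
    refine mul_left_cancel₀ (pow_ne_zero 2 hX) ?_
    linear_combination a₂
  have p₁ : p 1 = -(X 0 * p 4) := hinj <| by
    rw [map_neg, map_neg, map_mul, map_mul, k₂]
    refine mul_left_cancel₀ hX ?_
    linear_combination -b₂
  have p₀ : X 0 * p 0 = X 1 * p 4 := hinj <| by
    rw [map_mul, map_mul, map_mul, map_mul, k₂, k₄]
    linear_combination -X 1 * b₀ + X 3 * b₂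
  have p₂ : X 0 * p 2 = X 1 * (-2 * p 7) := hinj <| by
    have e : X 1 * (-2 * p 7) = -(2 * (X 1 * p 7)) := by ring
    rw [e, map_neg, map_neg, map_mul, map_mul, map_mul, map_mul, map_mul, map_mul, k₂, k₄,
      map_ofNat, map_ofNat]
    refine mul_left_cancel₀ hX ?_
    linear_combination X 1 * a₀ + 3 * X 3 * a₂
  have hdvd {q r : MvPolynomial (Fin 2) K} (hqr : X 0 * q = X 1 * r) : ∃ a, r = X 0 * a := by
    have h : (X 0 : MvPolynomial (Fin 2) K) ∣ X 1 * r := ⟨q, hqr.symm⟩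
    rcases X_dvd_mul_iff.1 h with h | h
    · exact absurd (X_dvd_X.1 h) (by decide)
    · exact h
  have hX0 : (X 0 : MvPolynomial (Fin 2) K) ≠ 0 := X_ne_zero 0
  obtain ⟨a, ha⟩ := hdvd p₀
  obtain ⟨b, hb⟩ := hdvd p₂
  have h2 : C (1 / 2) * 2 = (1 : MvPolynomial (Fin 2) K) := by
    rw [← map_ofNat (C : K →+* MvPolynomial (Fin 2) K) 2, ← C_mul]; simp
  have p₇ : p 7 = X 0 * (-C (1 / 2) * b) := by
    linear_combination (-C (1 / 2)) * hb - p 7 * h2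
  refine ⟨a, -C (1 / 2) * b, ?_⟩
  funext i
  fin_cases i
  · refine mul_left_cancel₀ hX0 ?_
    change X 0 * p 0 = X 0 * (X 1 * a)
    linear_combination p₀ + X 1 * ha
  · change p 1 = -(X 0 ^ 2 * a)
    linear_combination p₁ - X 0 * ha
  · refine mul_left_cancel₀ hX0 ?_
    change X 0 * p 2 = X 0 * -(2 * X 1 * (-C (1 / 2) * b))
    linear_combination p₂ - 2 * X 1 * p₇
  · change p 3 = X 0 ^ 2 * (-C (1 / 2) * b)
    linear_combination p₃ + X 0 * p₇
  exacts [ha, p₅, p₆, p₇]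

/-- An element whose product with `x_1` lies in the span lies in the span. -/
theorem mem_of_f₁_smul_mem [CharZero K] {u : CommutatorIdeal K (Fin 4)}
    (hu : f₁ K • u ∈ basisSpan K) : u ∈ basisSpan K := by
  obtain ⟨p, n, hn, h⟩ := exists_eq_sum_gens_add hu
  have h' : ∑ i, evalTwo K (p i) • gens K i = f₁ K • (u - n) := by
    rw [smul_sub, h, add_sub_cancel_right]
  obtain ⟨a, b, rfl⟩ := gens_relations h'
  have e : f₁ K • (3 : K) • (u - n) = f₁ K • (evalTwo K a • c₆ K - evalTwo K b • c₇ K) := by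
    have h₆ := f₁_smul_c₆ K
    have h₇ := f₁_smul_c₇ K
    rw [← C_smul, map_ofNat] at h₆ h₇ ⊢
    simp only [Fin.sum_univ_eight, gens] at h'
    simp only [Matrix.cons_val, map_zero, zero_smul, add_zero, map_neg, map_mul, map_pow,
      map_ofNat, evalTwo_X] at h'
    linear_combination (norm := module) (-3 : MvPolynomial (Fin 4) K) • h' - evalTwo K a • h₆
      + evalTwo K b • h₇
  have hmem : (3 : K) • (u - n) ∈ basisSpan K := by
    rw [f₁_smul_injective e]
    exact sub_mem (smul_c_mem (evalTwo_mem_range a) 5) (smul_c_mem (evalTwo_mem_range b) 6)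
  have := add_mem (Submodule.smul_mem _ (3 : K)⁻¹ hmem) hn
  rwa [inv_smul_smul₀ three_ne_zero, sub_add_cancel] at this

theorem mem_of_pow_smul_mem [CharZero K] {u : CommutatorIdeal K (Fin 4)} (k : ℕ)
    (hu : (X 0 : MvPolynomial (Fin 4) K) ^ k • u ∈ basisSpan K) : u ∈ basisSpan K := by
  induction k with
  | zero => simpa using hu
  | succ k ih =>
    refine ih (mem_of_f₁_smul_mem ?_)
    rwa [smul_smul, f₁, ← pow_succ']

/-! ### The span consists of all constants -/

/-- After inverting `x_1`, the commutator ideal is generated by `c_1`, `c_2` and `c_3`. -/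
theorem exists_pow_smul_eq (u : CommutatorIdeal K (Fin 4)) :
    ∃ p q r : MvPolynomial (Fin 4) K,
      (X 0 : MvPolynomial (Fin 4) K) ^ 3 • u = p • c₁ K + q • c₃ K + r • c₂ K := by
  obtain ⟨p₂₁, p₃₁, p₄₁, p₃₂, p₄₂, p₄₃, rfl⟩ := exists_com_combination u
  refine ⟨p₂₁ * X 0 ^ 3 + p₃₁ * X 0 ^ 2 * X 1 + p₄₁ * X 0 * (X 1 ^ 2 - X 0 * X 2)
      + p₃₂ * (X 0 * X 1 ^ 2 - X 0 ^ 2 * X 2)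
      + p₄₂ * (X 1 * (X 1 ^ 2 - X 0 * X 2) - X 0 ^ 2 * X 3)
      + p₄₃ * (X 2 * (X 1 ^ 2 - X 0 * X 2) - X 0 * X 1 * X 3),
    p₃₁ * X 0 ^ 2 + p₄₁ * X 0 * X 1 + p₃₂ * X 0 * X 1 + p₄₂ * X 1 ^ 2
      + p₄₃ * (X 1 * X 2 - X 0 * X 3),
    p₄₁ * X 0 ^ 3 + p₄₂ * X 0 ^ 2 * X 1 + p₄₃ * X 0 ^ 2 * X 2, ?_⟩
  apply fox_injective
  funext k
  simp only [map_add, map_smul, Pi.add_apply, Pi.smul_apply, fox_com, fox_c₁, fox_c₂, fox_c₃,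
    smul_eq_mul]
  fin_cases k <;> simp <;> ring

theorem eq_zero_of_combination {p q r : MvPolynomial (Fin 4) K}
    (h : p • c₁ K + q • c₃ K + r • c₂ K = 0) : p = 0 ∧ q = 0 ∧ r = 0 := by
  have hk (k : Fin 4) := congrFun (congrArg (fox K (Fin 4)) h) k
  simp only [map_add, map_smul, Pi.add_apply, Pi.smul_apply, fox_c₁, fox_c₂, fox_c₃, smul_eq_mul,
    map_zero, Pi.zero_apply] at hk
  have hr : r = 0 := by simpa using hk 3
  subst hr
  have hq : q = 0 := by simpa using hk 2
  subst hq
  exact ⟨by simpa using hk 1, rfl, rfl⟩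

theorem mem_basisSpan_iff [CharZero K] {u : CommutatorIdeal K (Fin 4)} :
    u ∈ basisSpan K ↔ u ∈ commConst (J K) := by
  refine ⟨mem_commConst_of_mem_basisSpan, fun hu => ?_⟩
  obtain ⟨p, q, r, h⟩ := exists_pow_smul_eq u
  have hc (j : Fin 7) : commDelta (J K) (c K j) = 0 := Subtype.ext (c_mem_commConst K j)
  have h₁ : commDelta (J K) (c₁ K) = 0 := hc 0
  have h₂ : commDelta (J K) (c₂ K) = 0 := hc 1
  have h₃ : commDelta (J K) (c₃ K) = 0 := hc 2
  have hu' : commDelta (J K) u = 0 := Subtype.ext hu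
  have h0 : polyDelta (J K) (X 0 ^ 3) = 0 := by
    rw [Derivation.leibniz_pow, polyDelta_X₁, smul_zero, smul_zero]
  have hd := congrArg (commDelta (J K)) h
  simp only [map_add, commDelta_smul, h₁, h₂, h₃, hu', h0, smul_zero, zero_smul, zero_add] at hd
  obtain ⟨hp, hq, hr⟩ := eq_zero_of_combination hd.symm
  obtain ⟨k₁, hk₁⟩ := exists_pow_mul_mem_fAlg hp
  obtain ⟨k₂, hk₂⟩ := exists_pow_mul_mem_fAlg hq
  obtain ⟨k₃, hk₃⟩ := exists_pow_mul_mem_fAlg hr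
  refine mem_of_pow_smul_mem (k₁ + k₂ + k₃ + 3) ?_
  have hb (j : Fin 7) : c K j ∈ basisSpan K := by
    simpa using smul_c_mem (one_mem (evalThree K).range) j
  rw [pow_add, mul_smul, h, smul_add, smul_add, smul_smul, smul_smul, smul_smul]
  exact add_mem (add_mem (fAlg_smul_mem (hk₁ _ (by omega)) (hb 0))
    (fAlg_smul_mem (hk₂ _ (by omega)) (hb 2))) (fAlg_smul_mem (hk₃ _ (by omega)) (hb 1))

end

section

variable {K : Type*} [Field K]

/-! ### Linear independence -/

/-- The only relation of the indicated shape between the `c_j` is the trivial one. The last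
coordinate modulo `(x_1, x_3)` isolates `c_6` and `c_7`; for the rest, `c_4 f_1²` and `c_5 f_1²` are
expressed by `c_1` and `c_3`. -/
theorem coeffs_eq_zero [CharZero K] {p : Fin 4 → MvPolynomial (Fin 3) K}
    {g : Fin 2 → MvPolynomial (Fin 2) K} {h : Fin 2 → MvPolynomial (Fin 3) K}
    (e : evalThree K (p 0) • c₁ K + evalThree K (p 1) • c₃ K + evalThree K (p 2) • c₄ K
      + evalThree K (p 3) • c₅ K + (evalTwo K (g 0) • c₆ K + evalTwo K (g 1) • c₇ K)
      + (evalThree K (h 0) • c₂ K + evalThree K (h 1) • f₃ K • c₂ K) = 0) :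
    p = 0 ∧ g = 0 ∧ h = 0 := by
  have hX : (X 1 : MvPolynomial (Fin 4) K) ≠ 0 := X_ne_zero 1
  have hX₂ : parity K (X 1) = -X 1 := parity_X K 1
  have hg : g 0 = 0 ∧ g 1 = 0 := by
    have h₃ := congrArg (killOneThree K) (congrFun (congrArg (fox K (Fin 4)) e) 3)
    simp only [map_add, map_smul, Pi.add_apply, Pi.smul_apply, smul_eq_mul, map_mul] at h₃
    simp [fox_c₁, fox_c₂, fox_c₃, fox_c₄, fox_c₅, fox_c₆, fox_c₇, killOneThree_X,
      map_ofNat] at h₃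
    have hpar (q : MvPolynomial (Fin 2) K) : parity K (killOneThree K (evalTwo K q))
        = killOneThree K (evalTwo K q) := by
      rw [parity_killOneThree, parity_evalTwo]
    obtain ⟨h₀, h₁⟩ := eq_zero_of_add_eq_zero
      (p := -(killOneThree K (evalTwo K (g 0)) * (3 * X 1 ^ 4)))
      (q := -(killOneThree K (evalTwo K (g 1)) * (3 * X 1 ^ 5)))
      (by simp only [map_neg, map_mul, map_pow, map_ofNat, hpar, hX₂]; ring)
      (by simp only [map_neg, map_mul, map_pow, map_ofNat, hpar, hX₂]; ring)
      (by linear_combination h₃)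
    exact ⟨killOneThree_evalTwo_eq_zero (by simpa [hX] using h₀),
      killOneThree_evalTwo_eq_zero (by simpa [hX] using h₁)⟩
  rw [hg.1, hg.2, map_zero, zero_smul, zero_smul, add_zero, add_zero] at e
  have hf₁ : f₁ K ≠ 0 := X_ne_zero 0
  have hf₃ : f₃ K ≠ 0 := fun h => by
    have := killOneThree_f₃ K
    rw [h, map_zero] at this
    exact pow_ne_zero 3 hX this.symm
  obtain ⟨e₁, e₃, e₂⟩ := eq_zero_of_combination
    (p := evalThree K (p 0) * f₁ K ^ 2 + evalThree K (p 2) * f₃ K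
      - evalThree K (p 3) * f₂ K ^ 2)
    (q := evalThree K (p 1) * f₁ K ^ 2 + evalThree K (p 2) * f₂ K - evalThree K (p 3) * f₃ K)
    (r := f₁ K ^ 2 * (evalThree K (h 0) + evalThree K (h 1) * f₃ K)) (by
      linear_combination (norm := module) (f₁ K ^ 2) • e
        + evalThree K (p 2) • f₃_smul_c₁ K - evalThree K (p 3) • f₃_smul_c₃ K)
  -- The `f_i` with `i ≠ 3` are even and `f_3` is odd.
  have split {a b : MvPolynomial (Fin 3) K} (hab : evalThree K a + evalThree K b * f₃ K = 0) :
      a = 0 ∧ b = 0 := by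
    obtain ⟨ha, hb⟩ := eq_zero_of_add_eq_zero (parity_evalThree a)
      (by rw [map_mul, parity_evalThree, parity_f₃, mul_neg]) hab
    exact ⟨evalThree_injective (by rw [ha, map_zero]),
      evalThree_injective (by rw [(mul_eq_zero.1 hb).resolve_right hf₃, map_zero])⟩
  obtain ⟨h₀, h₁⟩ := split ((mul_eq_zero.1 e₂).resolve_left (pow_ne_zero 2 hf₁))
  have k₁ : evalThree K (X 0) = f₁ K := evalThree_X K 0
  have k₂ : evalThree K (X 1) = f₂ K := evalThree_X K 1
  obtain ⟨e₁, p₂⟩ := split (a := p 0 * X 0 ^ 2 - p 3 * X 1 ^ 2) (b := p 2) (by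
    rw [map_sub, map_mul, map_mul, map_pow, map_pow, k₁, k₂]
    linear_combination e₁)
  obtain ⟨e₃, p₃⟩ := split (a := p 1 * X 0 ^ 2 + p 2 * X 1) (b := -p 3) (by
    rw [map_add, map_mul, map_mul, map_pow, map_neg, k₁, k₂]
    linear_combination e₃)
  rw [neg_eq_zero] at p₃
  have p₀ : p 0 = 0 := by simpa [p₃] using e₁
  have p₁ : p 1 = 0 := by simpa [p₂] using e₃
  refine ⟨?_, ?_, ?_⟩
  · funext i
    fin_cases i
    exacts [p₀, p₁, p₂, p₃]
  · funext i
    fin_cases i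
    exacts [hg.1, hg.2]
  · funext i
    fin_cases i
    exacts [h₀, h₁]

variable (K) in
/-- The linear map that sends coefficients to the corresponding combination of `c_1`, `c_3`, `c_4`,
`c_5` over `K[f_1, f_2, f_4]`, of `c_6`, `c_7` over `K[f_2, f_4]`, and of `c_2`, `c_2 f_3` over
`K[f_1, f_2, f_4]`. -/
def combine : ((Fin 4 → MvPolynomial (Fin 3) K) × (Fin 2 → MvPolynomial (Fin 2) K) ×
    (Fin 2 → MvPolynomial (Fin 3) K)) →ₗ[K] CommutatorIdeal K (Fin 4) :=
  let smul (u : CommutatorIdeal K (Fin 4)) : MvPolynomial (Fin 4) K →ₗ[K] _ :=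
    (LinearMap.toSpanSingleton (MvPolynomial (Fin 4) K) _ u).restrictScalars K
  (∑ j, smul (![c₁ K, c₃ K, c₄ K, c₅ K] j) ∘ₗ (evalThree K).toLinearMap ∘ₗ
      LinearMap.proj j).coprod
    ((∑ j, smul (![c₆ K, c₇ K] j) ∘ₗ (evalTwo K).toLinearMap ∘ₗ LinearMap.proj j).coprod
      (∑ j, smul (![c₂ K, f₃ K • c₂ K] j) ∘ₗ (evalThree K).toLinearMap ∘ₗ LinearMap.proj j))

theorem combine_apply (p : Fin 4 → MvPolynomial (Fin 3) K) (g : Fin 2 → MvPolynomial (Fin 2) K)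
    (h : Fin 2 → MvPolynomial (Fin 3) K) : combine K (p, g, h)
      = ∑ j, evalThree K (p j) • ![c₁ K, c₃ K, c₄ K, c₅ K] j
        + (∑ j, evalTwo K (g j) • ![c₆ K, c₇ K] j
          + ∑ j, evalThree K (h j) • ![c₂ K, f₃ K • c₂ K] j) := by
  simp only [combine, LinearMap.coprod_apply, LinearMap.sum_apply]
  rfl

theorem combine_injective [CharZero K] : Function.Injective (combine K) := by
  refine (injective_iff_map_eq_zero _).2 ?_
  rintro ⟨p, g, h⟩ e
  rw [combine_apply, Fin.sum_univ_four, Fin.sum_univ_two, Fin.sum_univ_two, ← add_assoc] at e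
  obtain ⟨rfl, rfl, rfl⟩ := coeffs_eq_zero e
  rfl

/-- The exponent vector of a triple. -/
def exponentThree (a : ℕ × ℕ × ℕ) : Fin 3 →₀ ℕ :=
  Finsupp.single 0 a.1 + Finsupp.single 1 a.2.1 + Finsupp.single 2 a.2.2

theorem exponentThree_injective : Function.Injective exponentThree := fun a b hab => by
  have h0 := DFunLike.congr_fun hab 0
  have h1 := DFunLike.congr_fun hab 1
  have h2 := DFunLike.congr_fun hab 2
  simp [exponentThree] at h0 h1 h2
  exact Prod.ext h0 (Prod.ext h1 h2)

theorem evalThree_monomial (q r s : ℕ) :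
    evalThree K (monomial (exponentThree (q, r, s)) 1) = f₁ K ^ q * f₂ K ^ r * f₄ K ^ s := by
  have hm : (monomial (exponentThree (q, r, s)) 1 : MvPolynomial (Fin 3) K)
      = X 0 ^ q * X 1 ^ r * X 2 ^ s := by
    simp [exponentThree, X_pow_eq_monomial, monomial_mul]
  rw [hm]
  simp only [map_mul, map_pow, evalThree_X]
  rfl

/-- The exponent vector of a pair. -/
def exponentTwo (a : ℕ × ℕ) : Fin 2 →₀ ℕ :=
  Finsupp.single 0 a.1 + Finsupp.single 1 a.2

theorem exponentTwo_injective : Function.Injective exponentTwo := fun a b hab => by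
  have h0 := DFunLike.congr_fun hab 0
  have h1 := DFunLike.congr_fun hab 1
  simp [exponentTwo] at h0 h1
  exact Prod.ext h0 h1

theorem evalTwo_monomial (r s : ℕ) :
    evalTwo K (monomial (exponentTwo (r, s)) 1) = f₂ K ^ r * f₄ K ^ s := by
  have hm : (monomial (exponentTwo (r, s)) 1 : MvPolynomial (Fin 2) K) = X 0 ^ r * X 1 ^ s := by
    simp [exponentTwo, X_pow_eq_monomial, monomial_mul]
  rw [hm]
  simp only [map_mul, map_pow, evalTwo_X]
  rfl

/-- The position of a member of the family `basisC` in the basis of the coefficient space that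
consists of the monomials. -/
def basisIndex : (Fin 4 × ℕ × ℕ × ℕ) ⊕ (Fin 2 × ℕ × ℕ) ⊕ (ℕ × ℕ × Fin 2 × ℕ) →
    (Σ _ : Fin 4, Fin 3 →₀ ℕ) ⊕ (Σ _ : Fin 2, Fin 2 →₀ ℕ) ⊕ (Σ _ : Fin 2, Fin 3 →₀ ℕ)
  | .inl (j, a) => .inl ⟨j, exponentThree a⟩
  | .inr (.inl (j, a)) => .inr (.inl ⟨j, exponentTwo a⟩)
  | .inr (.inr (q, r, e, s)) => .inr (.inr ⟨e, exponentThree (q, r, s)⟩)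

theorem basisIndex_injective : Function.Injective basisIndex := by
  rintro (⟨j, a⟩ | ⟨j, a⟩ | ⟨q, r, e, s⟩) (⟨j', a'⟩ | ⟨j', a'⟩ | ⟨q', r', e', s'⟩) h <;>
    simp only [basisIndex, Sum.inl.injEq, Sum.inr.injEq, Sigma.mk.injEq, heq_eq_eq,
      exponentThree_injective.eq_iff, exponentTwo_injective.eq_iff, reduceCtorEq,
      Prod.mk.injEq] at h ⊢
  · exact h
  · exact h
  · tauto

theorem linearIndependent_basisC [CharZero K] : LinearIndependent K (basisC K) := by
  let b := (Pi.basis fun _ : Fin 4 => basisMonomials (Fin 3) K).prod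
    ((Pi.basis fun _ : Fin 2 => basisMonomials (Fin 2) K).prod
      (Pi.basis fun _ : Fin 2 => basisMonomials (Fin 3) K))
  have h := (b.linearIndependent.map' (combine K)
    (LinearMap.ker_eq_bot.2 combine_injective)).comp basisIndex basisIndex_injective
  have hs₃ {n : ℕ} (v : Fin n → CommutatorIdeal K (Fin 4)) (j : Fin n)
      (m : MvPolynomial (Fin 3) K) : ∑ i, evalThree K (Pi.single (M := fun _ => _) j m i) • v i
        = evalThree K m • v j := by
    rw [Finset.sum_eq_single j (fun i _ hi => by rw [Pi.single_eq_of_ne hi, map_zero, zero_smul])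
      (by simp), Pi.single_eq_same]
  have hs₂ {n : ℕ} (v : Fin n → CommutatorIdeal K (Fin 4)) (j : Fin n)
      (m : MvPolynomial (Fin 2) K) : ∑ i, evalTwo K (Pi.single (M := fun _ => _) j m i) • v i
        = evalTwo K m • v j := by
    rw [Finset.sum_eq_single j (fun i _ hi => by rw [Pi.single_eq_of_ne hi, map_zero, zero_smul])
      (by simp), Pi.single_eq_same]
  have e : basisC K = (combine K ∘ b) ∘ basisIndex := by
    funext i
    obtain ⟨j, q, r, s⟩ | ⟨j, r, s⟩ | ⟨q, r, e, s⟩ := i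
    · have hb : b (basisIndex (.inl (j, q, r, s)))
          = (Pi.single j (monomial (exponentThree (q, r, s)) 1), 0, 0) := by
        simp [b, basisIndex]
        rfl
      rw [Function.comp_apply, Function.comp_apply, hb, combine_apply, hs₃, evalThree_monomial]
      simp [basisC]
    · have hb : b (basisIndex (.inr (.inl (j, r, s))))
          = (0, Pi.single j (monomial (exponentTwo (r, s)) 1), 0) := by
        simp [b, basisIndex]
      rw [Function.comp_apply, Function.comp_apply, hb, combine_apply, hs₂, evalTwo_monomial]
      simp [basisC]
    · have hb : b (basisIndex (.inr (.inr (q, r, e, s))))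
          = (0, 0, Pi.single e (monomial (exponentThree (q, r, s)) 1)) := by
        simp [b, basisIndex]
      rw [Function.comp_apply, Function.comp_apply, hb, combine_apply, hs₃, evalThree_monomial]
      fin_cases e
      · simp [basisC]
      · simp [basisC, smul_smul, mul_right_comm]
  rw [e]
  exact h

/-! ### Generators of the module and of the algebra of constants -/

theorem span_c_eq [CharZero K] :
    Submodule.span (polyConst (J K)) (Set.range (c K)) = commConst (J K) := by
  refine le_antisymm (Submodule.span_le.2 ?_) fun u hu => ?_
  · rintro _ ⟨j, rfl⟩
    exact c_mem_commConst K j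
  have h₁ := f₁_mem K
  have h₂ := f₂_mem K
  have h₃ := f₃_mem K
  have h₄ := f₄_mem K
  have hc (j : Fin 7) {p} (hp : p ∈ polyConst (J K)) :
      p • c K j ∈ Submodule.span (polyConst (J K)) (Set.range (c K)) :=
    Submodule.smul_mem _ (⟨p, hp⟩ : polyConst (J K)) (Submodule.subset_span ⟨j, rfl⟩)
  rw [← mem_basisSpan_iff] at hu
  induction hu using Submodule.span_induction with
  | mem x hx =>
    obtain ⟨⟨j, q, r, s⟩ | ⟨j, r, s⟩ | ⟨q, r, e, s⟩, rfl⟩ := hx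
    · have h := mul_mem (mul_mem (pow_mem h₁ q) (pow_mem h₂ r)) (pow_mem h₄ s)
      fin_cases j
      exacts [hc 0 h, hc 2 h, hc 3 h, hc 4 h]
    · have h := mul_mem (pow_mem h₂ r) (pow_mem h₄ s)
      fin_cases j
      exacts [hc 5 h, hc 6 h]
    · exact hc 1 (mul_mem (mul_mem (mul_mem (pow_mem h₁ q) (pow_mem h₂ r)) (pow_mem h₃ e))
        (pow_mem h₄ s))
  | zero => exact zero_mem _
  | add x y _ _ hx hy => exact add_mem hx hy
  | smul a x _ hx =>
    have := Submodule.smul_mem _ (algebraMap K (polyConst (J K)) a) hx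
    rwa [← C_smul]

/-- A constant is a multiple of `x_1` plus a constant of the commutator ideal: `δ` acts
injectively on the other linear forms. -/
theorem exists_eq_smul_gen_add {u : FreeMetabelian K (Fin 4)} (hu : lieDelta (J K) u = 0) :
    ∃ (a : K), ∃ s ∈ commConst (J K), u = a • gen K x₁ + (s : FreeMetabelian K (Fin 4)) := by
  obtain ⟨g, hg, s, -, rfl⟩ := exists_eq_gen_add_com u
  obtain ⟨a, rfl⟩ := (Submodule.mem_span_range_iff_exists_fun K).1 hg
  obtain ⟨d₁, d₂, d₃, d₄⟩ := lieDelta_J K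
  have hgen (i : Fin 4) : (magnus K (Fin 4) (gen K i)).pol = X i := by rw [magnus_gen]
  rw [Fin.sum_univ_four, map_add, map_add, map_add, map_add, map_smul, map_smul, map_smul, map_smul,
    d₁, d₂, d₃, d₄] at hu
  -- The linear part of `δ u`.
  have h := congrArg (fun v => (magnus K (Fin 4) v).pol) hu
  simp only [map_add, map_smul, map_zero, Magnus.pol_add, Magnus.pol_smul, Magnus.pol_zero, hgen,
    smul_zero, zero_add, magnus_pol_eq_zero K (lieDer_mem _ s.2), lieDelta, add_zero] at h
  have hz (i : Fin 4) := congrArg (eval (Pi.single i (1 : K))) h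
  have a₁ : a 1 = 0 := by simpa [smul_eq_C_mul, x₁, x₂, x₃] using hz 0
  have a₂ : a 2 = 0 := by simpa [smul_eq_C_mul, x₁, x₂, x₃] using hz 1
  have a₃ : a 3 = 0 := by simpa [smul_eq_C_mul, x₁, x₂, x₃] using hz 2
  refine ⟨a 0, s, ?_, by simp [Fin.sum_univ_four, a₁, a₂, a₃]⟩
  change lieDelta (J K) s = 0
  simpa [a₁, a₂, a₃] using hu

theorem lieSpan_algGens [CharZero K] :
    LieSubalgebra.lieSpan K (FreeMetabelian K (Fin 4)) (algGens K) = lieConst (J K) := by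
  have h₂ := f₂_mem K
  have h₃ := f₃_mem K
  have h₄ := f₄_mem K
  apply le_antisymm
  · refine LieSubalgebra.lieSpan_le.2 ?_
    have hc (j : Fin 7) {p} (hp : p ∈ polyConst (J K)) : p • c K j ∈ commConst (J K) :=
      (commConst (J K)).smul_mem ⟨p, hp⟩ (c_mem_commConst K j)
    rintro _ ((rfl | ⟨j, r, s, rfl⟩) | ⟨r, s, rfl⟩)
    · exact (lieDelta_J K).1
    · exact hc j (mul_mem (pow_mem h₂ r) (pow_mem h₄ s))
    · exact hc 1 (mul_mem (mul_mem (pow_mem h₂ r) h₃) (pow_mem h₄ s))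
  intro u hu
  set H := LieSubalgebra.lieSpan K (FreeMetabelian K (Fin 4)) (algGens K)
  have hsub : algGens K ⊆ H := LieSubalgebra.subset_lieSpan
  have hx : gen K x₁ ∈ H := hsub (.inl (.inl rfl))
  -- Multiplication by `f_1` is the bracket with `x_1`.
  have hpow (q : ℕ) (w : CommutatorIdeal K (Fin 4)) (hw : (w : FreeMetabelian K (Fin 4)) ∈ H) :
      ((f₁ K ^ q • w : CommutatorIdeal K (Fin 4)) : FreeMetabelian K (Fin 4)) ∈ H := by
    induction q with
    | zero => simpa using hw
    | succ q ih =>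
      rw [pow_succ', mul_smul, f₁, X_smul]
      exact H.lie_mem ih hx
  have hc (j : Fin 7) (q r s : ℕ) :
      (((f₁ K ^ q * f₂ K ^ r * f₄ K ^ s) • c K j : CommutatorIdeal K (Fin 4)) :
        FreeMetabelian K (Fin 4)) ∈ H := by
    rw [mul_assoc, mul_smul]
    exact hpow _ _ (hsub (.inl (.inr ⟨j, r, s, rfl⟩)))
  obtain ⟨a, t, ht, rfl⟩ := exists_eq_smul_gen_add hu
  refine add_mem (H.smul_mem a hx) ?_
  rw [← mem_basisSpan_iff] at ht
  clear hu
  induction ht using Submodule.span_induction with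
  | mem x hx =>
    obtain ⟨⟨j, q, r, s⟩ | ⟨j, r, s⟩ | ⟨q, r, e, s⟩, rfl⟩ := hx
    · fin_cases j
      exacts [hc 0 q r s, hc 2 q r s, hc 3 q r s, hc 4 q r s]
    · fin_cases j
      exacts [hsub (.inl (.inr ⟨5, r, s, rfl⟩)), hsub (.inl (.inr ⟨6, r, s, rfl⟩))]
    · fin_cases e
      · simpa [basisC, c] using hc 1 q r s
      · have h := hpow q _ (hsub (.inr ⟨r, s, rfl⟩))
        rw [smul_smul] at h
        simpa [basisC, c, mul_assoc] using h
  | zero => exact zero_mem _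
  | add x y _ _ hx hy => exact add_mem hx hy
  | smul a x _ hx => exact H.smul_mem a hx

end

end FreeMetab

end

open FreeMetab in
theorem mainTheorem4 (K : Type*) [Field K] [CharZero K] :
    -- the polynomials `f_1, …, f_4` are constants
    (f₁ K ∈ polyConst (J K) ∧ f₂ K ∈ polyConst (J K) ∧
      f₃ K ∈ polyConst (J K) ∧ f₄ K ∈ polyConst (J K)) ∧
    -- `c_1, …, c_7` generate the module of constants in the commutator ideal
    Submodule.span (polyConst (J K)) (Set.range (c K)) = commConst (J K) ∧
    -- the relations
    (f₃ K • c₁ K = -(f₂ K • c₃ K) + f₁ K ^ 2 • c₄ K ∧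
      f₃ K • c₃ K = -(f₂ K ^ 2 • c₁ K + f₁ K ^ 2 • c₅ K) ∧
      f₃ K • c₄ K = -((3 * f₄ K) • c₁ K + f₂ K • c₅ K) ∧
      f₁ K • c₆ K = (3 : K) • (f₄ K • c₁ K - f₂ K ^ 2 • c₂ K + f₂ K • c₅ K) ∧
      f₃ K • c₅ K = (3 * f₄ K) • c₃ K - f₂ K ^ 2 • c₄ K ∧
      f₁ K • c₇ K
        = (3 : K) • (-((f₂ K * f₃ K) • c₂ K) + (2 * f₄ K) • c₃ K - f₂ K ^ 2 • c₄ K) ∧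
      f₃ K • c₆ K = (3 * f₁ K * f₄ K) • c₄ K + f₂ K • c₇ K ∧
      f₃ K • c₇ K
        = (9 * f₁ K * f₂ K * f₄ K) • c₂ K - (6 * f₁ K * f₄ K) • c₅ K + f₂ K ^ 2 • c₆ K) ∧
    -- a basis of the vector space of constants in the commutator ideal
    (LinearIndependent K (basisC K) ∧
      (Submodule.span K (Set.range (basisC K)) : Set (CommutatorIdeal K (Fin 4)))
        = commConst (J K)) ∧
    -- generators of the algebra of constants
    LieSubalgebra.lieSpan K (FreeMetabelian K (Fin 4)) (algGens K) = lieConst (J K) :=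
  ⟨⟨f₁_mem K, f₂_mem K, f₃_mem K, f₄_mem K⟩, span_c_eq,
    ⟨f₃_smul_c₁ K, f₃_smul_c₃ K, f₃_smul_c₄ K, f₁_smul_c₆ K, f₃_smul_c₅ K, f₁_smul_c₇ K,
      f₃_smul_c₆ K, f₃_smul_c₇ K⟩,
    ⟨linearIndependent_basisC, Set.ext fun _ => mem_basisSpan_iff⟩, lieSpan_algGens⟩
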